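/- **Setting.** Let $n\ge 1$ and let $(\mathcal C,\mathbb E,\mathfrak s)$ be an $n$-exangulated category in the sense of Herschend–Liu–Nakaoka: $\mathcal C$ is an additive category, $\mathbb E:\mathcal C^{op}\times\mathcal C\to \mathrm{Ab}$ is an additive bifunctor, and $\mathfrak s$ is an exact realization of $\mathbb E$ that satisfies the axioms (EA1), (EA2), (EA2$^{op}$). Here $\mathfrak s$ assigns to each $\delta\in\mathbb E(C,A)$ a homotopy equivalence class (relative to the end terms) of complexes $X^0=A\to X^1\to\cdots\to X^n\to X^{n+1}=C$. If $X$ lies in $\mathfrak s(\delta)$, then $\langle X,\delta\rangle$ is called a distinguished $n$-exangle and $d_X^n:X^n\to X^{n+1}$ an $\mathfrak s$-deflation. A morphism $\langle X,\delta\rangle\to\langle Y,\rho\rangle$ of distinguished $n$-exangles is a morphism $f$ of complexes with $(f^0)_*\delta=(f^{n+1})^*\rho$. An object $P$ is projective if for every distinguished $n$-exangle $\langle X,\delta\rangle$ every morphism $P\to X^{n+1}$ factors through $d_X^n$. There are enough projectives if every object $C$ admits a distinguished $n$-exangle with $X^{n+1}=C$ and $X^1,\dots,X^n$ projective. Injective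 objects (every morphism $X^0\to I$ factors through $d_X^0$) and enough injectives are defined dually. For a full subcategory $\mathcal X$ closed under finite direct sums, $[\mathcal X]$ denotes the ideal of morphisms that factor through an object of $\mathcal X$. Write $\underline{\mathcal C}=\mathcal C/[\text{projectives}]$ and $\overline{\mathcal C}=\mathcal C/[\text{injectives}]$. For an additive category $\mathcal A$, $\mathrm{mod}\,\mathcal A$ is the category of finitely presented functors $F:\mathcal A^{op}\to\mathrm{Ab}$, i.e. those with an exact sequence $\mathcal A(-,X)\to\mathcal A(-,Y)\to F\to 0$. Let $\mathfrak s\text{-}\mathrm{def}\,\mathcal C$ be the full subcategory of the morphism category of $\mathcal C$ whose objects are the $\mathfrak s$-deflations, and $\mathrm{s}\text{-}\mathrm{epi}\,\mathcal C$ its full subcategory of split epimorphisms. For a distinguished $n$-exangle $\langle X,\delta\rangle$, the contravariant defect is $\widetilde\delta=\mathrm{Coker}\big(\mathcal C(-,X^n)\to\mathcal C(-,X^{n+1})\big)$ (it depends only on the deflation $d_X^n$), and the covariant defect is $\check\delta=\mathrm{Coker}\big(\mathcal C(X^1,-)\to\mathcal C(X^0,-)\big)$. **Proposition.** (1) Suppose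 that $\mathcal C$ has enough projectives. Then $\mathfrak s\text{-}\mathrm{def}\,\mathcal C/[\mathrm{s}\text{-}\mathrm{epi}\,\mathcal C]$ and $\mathrm{mod}\,\underline{\mathcal C}$ are abelian categories, and there is an additive equivalence $$\Theta:\ \mathfrak s\text{-}\mathrm{def}\,\mathcal C/[\mathrm{s}\text{-}\mathrm{epi}\,\mathcal C]\ \xrightarrow{\ \simeq\ }\ \mathrm{mod}\,\underline{\mathcal C}$$ induced by the contravariant defect: the composite of the projection $\mathfrak s\text{-}\mathrm{def}\,\mathcal C\to\mathfrak s\text{-}\mathrm{def}\,\mathcal C/[\mathrm{s}\text{-}\mathrm{epi}\,\mathcal C]$, of $\Theta$, and of restriction along $\mathcal C\to\underline{\mathcal C}$ is naturally isomorphic to $d_X^n\mapsto\widetilde\delta$. (2) Suppose that $\mathcal C$ has enough injectives. Then $\mathfrak s\text{-}\mathrm{def}\,\mathcal C/[\mathrm{s}\text{-}\mathrm{epi}\,\mathcal C]$ and $\mathrm{mod}(\overline{\mathcal C}^{op})$ are abelian categories, and there is an additive equivalence $$\Phi:\ \mathfrak s\text{-}\mathrm{def}\,\mathcal C/[\mathrm{s}\text{-}\mathrm{epi}\,\mathcal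 C]\ \xrightarrow{\ \simeq\ }\ \big(\mathrm{mod}(\overline{\mathcal C}^{op})\big)^{op}$$ induced by the covariant defect: for distinguished $n$-exangles $\langle X,\delta\rangle$, the restriction of $\Phi(d_X^n)$ along $\mathcal C\to\overline{\mathcal C}$ is isomorphic to $\check\delta$, naturally with respect to all morphisms of distinguished $n$-exangles. -/

import Mathlib

open CategoryTheory CategoryTheory.Limits Opposite

universe w v u

namespace NExangulated

set_option linter.unusedSectionVars false

noncomputable section

/-! ### Ideals, quotient categories, finitely presented modules -/

section General

variable {𝒜 : Type u} [Category.{v} 𝒜] [Preadditive 𝒜]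

/-- The ideal `[𝒳]` of `𝒜` generated by the morphisms that factor through an object with the
property `P`. When `P` is closed under finite direct sums, it consists exactly of the morphisms
that factor through such an object (see `mem_ideal_iff`). -/
def ideal (P : ObjectProperty 𝒜) (X Y : 𝒜) : AddSubgroup (X ⟶ Y) :=
  AddSubgroup.closure {f | ∃ (Z : 𝒜) (_ : P Z) (g : X ⟶ Z) (h : Z ⟶ Y), g ≫ h = f}

lemma comp_mem_ideal (P : ObjectProperty 𝒜) {X Y Z : 𝒜} (f : X ⟶ Y) {g : Y ⟶ Z}
    (hg : g ∈ ideal P Y Z) : f ≫ g ∈ ideal P X Z := by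
  induction hg using AddSubgroup.closure_induction with
  | mem x hx =>
    obtain ⟨W, hW, a, b, rfl⟩ := hx
    exact AddSubgroup.subset_closure ⟨W, hW, f ≫ a, b, by simp⟩
  | zero => simp
  | add x y _ _ hx hy => simpa using (ideal P X Z).add_mem hx hy
  | neg x _ hx => simpa using (ideal P X Z).neg_mem hx

lemma mem_ideal_comp (P : ObjectProperty 𝒜) {X Y Z : 𝒜} {f : X ⟶ Y} (g : Y ⟶ Z)
    (hf : f ∈ ideal P X Y) : f ≫ g ∈ ideal P X Z := by
  induction hf using AddSubgroup.closure_induction with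
  | mem x hx =>
    obtain ⟨W, hW, a, b, rfl⟩ := hx
    exact AddSubgroup.subset_closure ⟨W, hW, a, b ≫ g, by simp⟩
  | zero => simp
  | add x y _ _ hx hy => simpa using (ideal P X Z).add_mem hx hy
  | neg x _ hx => simpa using (ideal P X Z).neg_mem hx

lemma mem_ideal_iff (P : ObjectProperty 𝒜)
    (hP₀ : ∃ Z, P Z)
    (hP : ∀ Z Z', P Z → P Z' → ∃ b : BinaryBicone Z Z', Nonempty b.IsBilimit ∧ P b.pt)
    {X Y : 𝒜} (f : X ⟶ Y) :
    f ∈ ideal P X Y ↔ ∃ (Z : 𝒜) (_ : P Z) (g : X ⟶ Z) (h : Z ⟶ Y), g ≫ h = f := by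
  refine ⟨fun hf => ?_, fun hf => AddSubgroup.subset_closure hf⟩
  induction hf using AddSubgroup.closure_induction with
  | mem x hx => exact hx
  | zero =>
    obtain ⟨Z, hZ⟩ := hP₀
    exact ⟨Z, hZ, 0, 0, by simp⟩
  | add x y _ _ hx hy =>
    obtain ⟨Z, hZ, g, h, rfl⟩ := hx
    obtain ⟨Z', hZ', g', h', rfl⟩ := hy
    obtain ⟨b, -, hb⟩ := hP Z Z' hZ hZ'
    exact ⟨b.pt, hb, g ≫ b.inl + g' ≫ b.inr, b.fst ≫ h + b.snd ≫ h', by simp⟩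
  | neg x _ hx =>
    obtain ⟨Z, hZ, g, h, rfl⟩ := hx
    exact ⟨Z, hZ, -g, h, by simp⟩

/-- Two morphisms are identified when their difference lies in the ideal `[𝒳]`. -/
def idealRel (P : ObjectProperty 𝒜) : HomRel 𝒜 := fun X Y f g => f - g ∈ ideal P X Y

instance idealRel_congruence (P : ObjectProperty 𝒜) : Congruence (idealRel P) where
  equivalence {X Y} :=
    { refl := fun f => by simp [idealRel, (ideal P X Y).zero_mem]
      symm := fun {f g} h => by
        simpa [idealRel] using (ideal P X Y).neg_mem h
      trans := fun {f g k} h₁ h₂ => by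
        simpa [idealRel] using (ideal P X Y).add_mem h₁ h₂ }
  comp_left f _ _ h := by
    simpa [idealRel, Preadditive.comp_sub] using comp_mem_ideal P f h
  comp_right g h := by
    simpa [idealRel, Preadditive.sub_comp] using mem_ideal_comp P g h

/-- The quotient category `𝒜/[𝒳]`. -/
abbrev IdealQuotient (P : ObjectProperty 𝒜) := CategoryTheory.Quotient (idealRel P)

/-- The projection `𝒜 ⥤ 𝒜/[𝒳]`. -/
abbrev toQuotient (P : ObjectProperty 𝒜) : 𝒜 ⥤ IdealQuotient P :=
  CategoryTheory.Quotient.functor (idealRel P)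

instance idealQuotient_preadditive (P : ObjectProperty 𝒜) : Preadditive (IdealQuotient P) :=
  CategoryTheory.Quotient.preadditive (idealRel P) (by
    intro X Y f₁ f₂ g₁ g₂ h₁ h₂
    have h := (ideal P X Y).add_mem h₁ h₂
    rwa [sub_add_sub_comm] at h)

variable (𝒜) in
/-- The category of right `𝒜`-modules, i.e. contravariant functors from `𝒜` to abelian groups. -/
abbrev RightMod := 𝒜ᵒᵖ ⥤ AddCommGrpCat.{v}

/-- A right `𝒜`-module `F` is finitely presented if there is an exact sequence
`𝒜(-, X) ⟶ 𝒜(-, Y) ⟶ F ⟶ 0`. -/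
def IsFinitelyPresented : ObjectProperty (RightMod 𝒜) := fun F =>
  ∃ (X Y : 𝒜) (φ : preadditiveYoneda.obj X ⟶ preadditiveYoneda.obj Y)
    (p : preadditiveYoneda.obj Y ⟶ F) (hp : φ ≫ p = 0),
      Nonempty (IsColimit (CokernelCofork.ofπ p hp))

variable (𝒜) in
/-- The category `mod 𝒜` of finitely presented right `𝒜`-modules. -/
abbrev FPMod := (IsFinitelyPresented (𝒜 := 𝒜)).FullSubcategory

variable (𝒜) in
/-- The given preadditive category is an abelian category. -/
def IsAbelianCategory : Prop :=
  ∃ h : Abelian 𝒜, h.toPreadditive = (inferInstance : Preadditive 𝒜)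

end General

variable {𝒞 : Type u} [Category.{v} 𝒞] [Preadditive 𝒞]

/-! ### Complexes of length `n + 2` -/

section Complexes

variable (𝒞) in
/-- The complexes `X⁰ ⟶ X¹ ⟶ ⋯ ⟶ Xⁿ⁺¹` in `𝒞`: complexes whose components are zero outside
the degrees `0, …, n + 1`. -/
structure Cpx (n : ℕ) where
  K : CochainComplex 𝒞 ℕ
  isZero : ∀ i, n + 1 < i → IsZero (K.X i)

/-- The complexes of length `n + 2` starting in `A` and ending in `C`. The identifications of the
end terms with `A` and `C` are recorded as isomorphisms. -/
structure CpxBetween (n : ℕ) (A C : 𝒞) extends Cpx 𝒞 n where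
  left : K.X 0 ≅ A
  right : K.X (n + 1) ≅ C

/-- A complex of length `n + 2`, as a complex between its own end terms. -/
def Cpx.between {n : ℕ} (X : Cpx 𝒞 n) : CpxBetween n (X.K.X 0) (X.K.X (n + 1)) where
  toCpx := X
  left := Iso.refl _
  right := Iso.refl _

namespace CpxBetween

variable {n : ℕ} {A C : 𝒞}

/-- The morphism `d⁰ : A ⟶ X¹`. -/
def dFirst (X : CpxBetween n A C) : A ⟶ X.K.X 1 := X.left.inv ≫ X.K.d 0 1

/-- The morphism `dⁿ : Xⁿ ⟶ C`. -/
def dLast (X : CpxBetween n A C) : X.K.X n ⟶ C := X.K.d n (n + 1) ≫ X.right.hom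

/-- The morphism of complexes `f` has degree `0` component `a` and degree `n + 1` component `c`. -/
def HasEnds {A' C' : 𝒞} (X : CpxBetween n A C) (Y : CpxBetween n A' C') (f : X.K ⟶ Y.K)
    (a : A ⟶ A') (c : C ⟶ C') : Prop :=
  f.f 0 ≫ Y.left.hom = X.left.hom ≫ a ∧ f.f (n + 1) ≫ Y.right.hom = X.right.hom ≫ c

/-- Homotopy equivalence of complexes with fixed ends: the two mutually inverse (up to homotopy)
morphisms of complexes are the identity on both ends. -/
def HtpyEquiv (X Y : CpxBetween n A C) : Prop :=
  ∃ e : HomotopyEquiv X.K Y.K, HasEnds X Y e.hom (𝟙 A) (𝟙 C) ∧ HasEnds Y X e.inv (𝟙 A) (𝟙 C)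

instance setoid (n : ℕ) (A C : 𝒞) : Setoid (CpxBetween n A C) where
  r := HtpyEquiv
  iseqv :=
    { refl := fun X => ⟨HomotopyEquiv.refl X.K, by simp [HasEnds, HomotopyEquiv.refl]⟩
      symm := by
        rintro X Y ⟨e, h₁, h₂⟩
        exact ⟨e.symm, h₂, h₁⟩
      trans := by
        rintro X Y Z ⟨e, ⟨h₁, h₂⟩, ⟨h₃, h₄⟩⟩ ⟨e', ⟨h₁', h₂'⟩, ⟨h₃', h₄'⟩⟩
        simp only [Category.comp_id] at h₁ h₂ h₃ h₄ h₁' h₂' h₃' h₄'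
        refine ⟨e.trans e', ⟨?_, ?_⟩, ⟨?_, ?_⟩⟩ <;>
          simp [HomotopyEquiv.trans, *] }

end CpxBetween

/-- Homotopy equivalence classes of complexes of length `n + 2` from `A` to `C`. -/
abbrev HtpyClass (n : ℕ) (A C : 𝒞) := _root_.Quotient (CpxBetween.setoid n A C)

end Complexes

/-! ### Mapping cones and cocones -/

section Cones

variable [HasZeroObject 𝒞] [HasBinaryBiproducts 𝒞]

section Keep

open scoped ZeroObject

open scoped Classical in
/-- The object `Z` if `p` holds, and `0` otherwise. -/
def keep (p : Prop) (Z : 𝒞) : 𝒞 := if p then Z else 0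

lemma keep_pos {p : Prop} (hp : p) (Z : 𝒞) : keep p Z = Z := if_pos hp

lemma isZero_keep {p : Prop} (hp : ¬ p) (Z : 𝒞) : IsZero (keep p Z) := by
  rw [keep, if_neg hp]
  exact isZero_zero 𝒞

open scoped Classical in
/-- The identity of `Z` if `p` holds, and `0` otherwise. -/
def keepι (p : Prop) (Z : 𝒞) : keep p Z ⟶ Z :=
  if hp : p then eqToHom (keep_pos hp Z) else 0

open scoped Classical in
/-- The identity of `Z` if `p` holds, and `0` otherwise. -/
def keepπ (p : Prop) (Z : 𝒞) : Z ⟶ keep p Z :=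
  if hp : p then eqToHom (keep_pos hp Z).symm else 0

@[simp]
lemma keepι_keepπ (p : Prop) (Z : 𝒞) : keepι p Z ≫ keepπ p Z = 𝟙 _ := by
  by_cases hp : p
  · simp [keepι, keepπ, hp]
  · exact (isZero_keep hp Z).eq_of_src _ _

lemma keepπ_keepι {p : Prop} (hp : p) (Z : 𝒞) : keepπ p Z ≫ keepι p Z = 𝟙 _ := by
  simp [keepι, keepπ, hp]

/-- `Z` itself, if `p` holds. -/
def keepIso {p : Prop} (hp : p) (Z : 𝒞) : keep p Z ≅ Z where
  hom := keepι p Z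
  inv := keepπ p Z
  hom_inv_id := keepι_keepπ p Z
  inv_hom_id := keepπ_keepι hp Z

end Keep

/-- A biproduct whose first summand is zero. -/
def biprodZeroLeft {X Y : 𝒞} (hX : IsZero X) : X ⊞ Y ≅ Y where
  hom := biprod.snd
  inv := biprod.inr
  hom_inv_id := by
    apply biprod.hom_ext
    · exact hX.eq_of_tgt _ _
    · simp
  inv_hom_id := by simp

lemma isZero_biprod {X Y : 𝒞} (hX : IsZero X) (hY : IsZero Y) : IsZero (X ⊞ Y) :=
  hY.of_iso (biprodZeroLeft hX)

/-- The terms `X¹`, `X² ⊞ Y¹`, `X³ ⊞ Y²`, … -/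
abbrev coneObj (X Y : CochainComplex 𝒞 ℕ) : ℕ → 𝒞
  | 0 => X.X 1
  | i + 1 => X.X (i + 2) ⊞ Y.X (i + 1)

/-- The differentials `[-d; f]` and `[-d, 0; f, d]`. -/
def coneD {X Y : CochainComplex 𝒞 ℕ} (f : X ⟶ Y) : ∀ i, coneObj X Y i ⟶ coneObj X Y (i + 1)
  | 0 => biprod.lift (-X.d 1 2) (f.f 1)
  | i + 1 => biprod.lift (-(biprod.fst ≫ X.d (i + 2) (i + 3)))
      (biprod.fst ≫ f.f (i + 2) + biprod.snd ≫ Y.d (i + 1) (i + 2))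

/-- For a morphism of complexes `f : X ⟶ Y`, the complex
`X¹ ⟶ X² ⊞ Y¹ ⟶ X³ ⊞ Y² ⟶ ⋯` with differentials
`[-d; f]` in degree `0` and `[-d, 0; f, d]` in positive degrees. -/
abbrev coneCpx {X Y : CochainComplex 𝒞 ℕ} (f : X ⟶ Y) : CochainComplex 𝒞 ℕ :=
  CochainComplex.of (coneObj X Y) (coneD f)
    (fun i => by
      match i with
      | 0 =>
        change (biprod.lift (-X.d 1 2) (f.f 1) : X.X 1 ⟶ X.X 2 ⊞ Y.X 1) ≫
          (biprod.lift (-(biprod.fst ≫ X.d 2 3)) (biprod.fst ≫ f.f 2 + biprod.snd ≫ Y.d 1 2) :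
            X.X 2 ⊞ Y.X 1 ⟶ X.X 3 ⊞ Y.X 2) = 0
        apply biprod.hom_ext <;> simp
      | i + 1 =>
        change (biprod.lift (-(biprod.fst ≫ X.d (i + 2) (i + 3)))
            (biprod.fst ≫ f.f (i + 2) + biprod.snd ≫ Y.d (i + 1) (i + 2)) :
              X.X (i + 2) ⊞ Y.X (i + 1) ⟶ X.X (i + 3) ⊞ Y.X (i + 2)) ≫
          (biprod.lift (-(biprod.fst ≫ X.d (i + 3) (i + 4)))
            (biprod.fst ≫ f.f (i + 3) + biprod.snd ≫ Y.d (i + 2) (i + 3)) :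
              X.X (i + 3) ⊞ Y.X (i + 2) ⟶ X.X (i + 4) ⊞ Y.X (i + 3)) = 0
        apply biprod.hom_ext <;> simp)

lemma coneCpx_d_zero {X Y : CochainComplex 𝒞 ℕ} (f : X ⟶ Y) :
    (coneCpx f).d 0 1 = (biprod.lift (-X.d 1 2) (f.f 1) : X.X 1 ⟶ X.X 2 ⊞ Y.X 1) :=
  CochainComplex.of_d (coneObj X Y) (coneD f) 0

lemma coneCpx_d_succ {X Y : CochainComplex 𝒞 ℕ} (f : X ⟶ Y) (i : ℕ) :
    (coneCpx f).d (i + 1) (i + 2) =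
      (biprod.lift (-(biprod.fst ≫ X.d (i + 2) (i + 3)))
        (biprod.fst ≫ f.f (i + 2) + biprod.snd ≫ Y.d (i + 1) (i + 2)) :
        X.X (i + 2) ⊞ Y.X (i + 1) ⟶ X.X (i + 3) ⊞ Y.X (i + 2)) :=
  CochainComplex.of_d (coneObj X Y) (coneD f) (i + 1)

/-- The terms `X⁰`, `X¹ ⊞ Y⁰`, `X² ⊞ Y¹`, …, where the terms of `X` and `Y` of degree larger than
`n` are replaced by zero. -/
abbrev coconeObj (n : ℕ) (X Y : CochainComplex 𝒞 ℕ) : ℕ → 𝒞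
  | 0 => X.X 0
  | i + 1 => keep (i + 1 ≤ n) (X.X (i + 1)) ⊞ keep (i ≤ n) (Y.X i)

/-- The differentials `[d; h]` and `[d, 0; h, -d]`. -/
def coconeD (n : ℕ) {X Y : CochainComplex 𝒞 ℕ} (h : X ⟶ Y) :
    ∀ i, coconeObj n X Y i ⟶ coconeObj n X Y (i + 1)
  | 0 => biprod.lift (X.d 0 1 ≫ keepπ _ _) (h.f 0 ≫ keepπ _ _)
  | i + 1 => biprod.lift
      (biprod.fst ≫ keepι _ _ ≫ X.d (i + 1) (i + 2) ≫ keepπ _ _)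
      (biprod.fst ≫ keepι _ _ ≫ h.f (i + 1) ≫ keepπ _ _ -
        biprod.snd ≫ keepι _ _ ≫ Y.d i (i + 1) ≫ keepπ _ _)

/-- For a morphism of complexes `h : X ⟶ Y`, the complex
`X⁰ ⟶ X¹ ⊞ Y⁰ ⟶ X² ⊞ Y¹ ⟶ ⋯ ⟶ Xⁿ ⊞ Yⁿ⁻¹ ⟶ 0 ⊞ Yⁿ` with differentials
`[d; h]` in degree `0` and `[d, 0; h, -d]` in positive degrees. The terms of `X` and `Y` of degree
larger than `n` are replaced by zero. -/
abbrev coconeCpx (n : ℕ) {X Y : CochainComplex 𝒞 ℕ} (h : X ⟶ Y) : CochainComplex 𝒞 ℕ :=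
  CochainComplex.of (coconeObj n X Y) (coconeD n h)
    (fun i => by
      match i with
      | 0 =>
        change (biprod.lift (X.d 0 1 ≫ keepπ _ _) (h.f 0 ≫ keepπ _ _) :
            X.X 0 ⟶ keep (1 ≤ n) (X.X 1) ⊞ keep (0 ≤ n) (Y.X 0)) ≫
          (biprod.lift (biprod.fst ≫ keepι _ _ ≫ X.d 1 2 ≫ keepπ _ _)
            (biprod.fst ≫ keepι _ _ ≫ h.f 1 ≫ keepπ _ _ -
              biprod.snd ≫ keepι _ _ ≫ Y.d 0 1 ≫ keepπ _ _) :
            keep (1 ≤ n) (X.X 1) ⊞ keep (0 ≤ n) (Y.X 0) ⟶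
              keep (2 ≤ n) (X.X 2) ⊞ keep (1 ≤ n) (Y.X 1)) = 0
        by_cases hn : 1 ≤ n
        · apply biprod.hom_ext <;>
            simp [reassoc_of% (keepπ_keepι hn), reassoc_of% (keepπ_keepι (Nat.zero_le n))]
        · exact (isZero_biprod (isZero_keep (by omega) _) (isZero_keep hn _)).eq_of_tgt _ _
      | i + 1 =>
        change (biprod.lift (biprod.fst ≫ keepι _ _ ≫ X.d (i + 1) (i + 2) ≫ keepπ _ _)
            (biprod.fst ≫ keepι _ _ ≫ h.f (i + 1) ≫ keepπ _ _ -
              biprod.snd ≫ keepι _ _ ≫ Y.d i (i + 1) ≫ keepπ _ _) :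
            keep (i + 1 ≤ n) (X.X (i + 1)) ⊞ keep (i ≤ n) (Y.X i) ⟶
              keep (i + 2 ≤ n) (X.X (i + 2)) ⊞ keep (i + 1 ≤ n) (Y.X (i + 1))) ≫
          (biprod.lift (biprod.fst ≫ keepι _ _ ≫ X.d (i + 2) (i + 3) ≫ keepπ _ _)
            (biprod.fst ≫ keepι _ _ ≫ h.f (i + 2) ≫ keepπ _ _ -
              biprod.snd ≫ keepι _ _ ≫ Y.d (i + 1) (i + 2) ≫ keepπ _ _) :
            keep (i + 2 ≤ n) (X.X (i + 2)) ⊞ keep (i + 1 ≤ n) (Y.X (i + 1)) ⟶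
              keep (i + 3 ≤ n) (X.X (i + 3)) ⊞ keep (i + 2 ≤ n) (Y.X (i + 2))) = 0
        by_cases hn : i + 2 ≤ n
        · have hn' : i + 1 ≤ n := by omega
          apply biprod.hom_ext <;>
            simp [reassoc_of% (keepπ_keepι hn), reassoc_of% (keepπ_keepι hn')]
        · exact (isZero_biprod (isZero_keep (by omega) _) (isZero_keep hn _)).eq_of_tgt _ _)

lemma coconeCpx_d_zero (n : ℕ) {X Y : CochainComplex 𝒞 ℕ} (h : X ⟶ Y) :
    (coconeCpx n h).d 0 1 = (biprod.lift (X.d 0 1 ≫ keepπ _ _) (h.f 0 ≫ keepπ _ _) :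
      X.X 0 ⟶ keep (1 ≤ n) (X.X 1) ⊞ keep (0 ≤ n) (Y.X 0)) :=
  CochainComplex.of_d (coconeObj n X Y) (coconeD n h) 0

lemma coconeCpx_d_succ (n : ℕ) {X Y : CochainComplex 𝒞 ℕ} (h : X ⟶ Y) (i : ℕ) :
    (coconeCpx n h).d (i + 1) (i + 2) =
      (biprod.lift (biprod.fst ≫ keepι _ _ ≫ X.d (i + 1) (i + 2) ≫ keepπ _ _)
        (biprod.fst ≫ keepι _ _ ≫ h.f (i + 1) ≫ keepπ _ _ -
          biprod.snd ≫ keepι _ _ ≫ Y.d i (i + 1) ≫ keepπ _ _) :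
        keep (i + 1 ≤ n) (X.X (i + 1)) ⊞ keep (i ≤ n) (Y.X i) ⟶
          keep (i + 2 ≤ n) (X.X (i + 2)) ⊞ keep (i + 1 ≤ n) (Y.X (i + 1))) :=
  CochainComplex.of_d (coconeObj n X Y) (coconeD n h) (i + 1)

variable {n : ℕ}

/-- The mapping cone
`X¹ ⟶ X² ⊞ Y¹ ⟶ ⋯ ⟶ Xⁿ⁺¹ ⊞ Yⁿ ⟶ Yⁿ⁺¹ = D` of a morphism `f` of complexes (meant for
`f⁰ = 𝟙 A`). In degree `n + 1` the summand `Xⁿ⁺²` is zero. -/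
def mappingCone {A C D : 𝒞} (X : CpxBetween n A C) (Y : CpxBetween n A D) (f : X.K ⟶ Y.K) :
    CpxBetween n (X.K.X 1) D where
  K := coneCpx f
  isZero i hi := by
    obtain ⟨j, rfl⟩ : ∃ j, i = j + 1 := ⟨i - 1, by omega⟩
    exact isZero_biprod (X.isZero _ (by omega)) (Y.isZero _ (by omega))
  left := Iso.refl _
  right := biprodZeroLeft (X.isZero (n + 2) (by omega)) ≪≫ Y.right

/-- The mapping cocone
`A = X⁰ ⟶ X¹ ⊞ Y⁰ ⟶ ⋯ ⟶ Xⁿ ⊞ Yⁿ⁻¹ ⟶ Yⁿ` of a morphism `h` of complexes (meant for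
`hⁿ⁺¹ = 𝟙 C`), with differentials `[d; h]`, then `[d, 0; h, -d]`, and finally `[h, -d]`. -/
def mappingCocone {A B C : 𝒞} (X : CpxBetween n A C) (Y : CpxBetween n B C) (h : X.K ⟶ Y.K) :
    CpxBetween n A (Y.K.X n) where
  K := coconeCpx n h
  isZero i hi := by
    obtain ⟨j, rfl⟩ : ∃ j, i = j + 1 := ⟨i - 1, by omega⟩
    have h₁ : ¬ j + 1 ≤ n := by omega
    have h₂ : ¬ j ≤ n := by omega
    exact isZero_biprod (isZero_keep h₁ _) (isZero_keep h₂ _)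
  left := X.left
  right :=
    have h₁ : ¬ n + 1 ≤ n := by omega
    biprodZeroLeft (isZero_keep h₁ (X.K.X (n + 1))) ≪≫ keepIso (le_refl n) (Y.K.X n)

end Cones

/-! ### `n`-exangulated categories -/

section Exangulated

variable (𝔼 : 𝒞ᵒᵖ ⥤ 𝒞 ⥤ AddCommGrpCat.{w})

/-- The group `𝔼(C, A)` of extensions. -/
abbrev Ext (C A : 𝒞) : Type w := (𝔼.obj (op C)).obj A

variable {𝔼}

/-- The extension `a_* δ`. -/
def push {C A A' : 𝒞} (a : A ⟶ A') (δ : Ext 𝔼 C A) : Ext 𝔼 C A' := (𝔼.obj (op C)).map a δ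

/-- The extension `c^* δ`. -/
def pull {C C' A : 𝒞} (c : C' ⟶ C) (δ : Ext 𝔼 C A) : Ext 𝔼 C' A := (𝔼.map c.op).app A δ

/-- `⟨X, δ⟩` is an `n`-exangle: the sequences of functors
`𝒞(-, X⁰) ⟶ ⋯ ⟶ 𝒞(-, Xⁿ⁺¹) ⟶ 𝔼(-, X⁰)` and `𝒞(Xⁿ⁺¹, -) ⟶ ⋯ ⟶ 𝒞(X⁰, -) ⟶ 𝔼(Xⁿ⁺¹, -)` are
exact (that they compose to zero in the inner terms holds as `X` is a complex). -/
structure IsExangle {n : ℕ} {A C : 𝒞} (X : CpxBetween n A C) (δ : Ext 𝔼 C A) : Prop where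
  exact_contra : ∀ (i : ℕ), i < n → ∀ (T : 𝒞) (f : T ⟶ X.K.X (i + 1)),
    f ≫ X.K.d (i + 1) (i + 2) = 0 → ∃ g : T ⟶ X.K.X i, g ≫ X.K.d i (i + 1) = f
  exact_contra_last : ∀ (T : 𝒞) (f : T ⟶ C),
    pull f δ = 0 ↔ ∃ g : T ⟶ X.K.X n, g ≫ X.dLast = f
  exact_co : ∀ (i : ℕ), i < n → ∀ (T : 𝒞) (f : X.K.X (i + 1) ⟶ T),
    X.K.d i (i + 1) ≫ f = 0 → ∃ g : X.K.X (i + 2) ⟶ T, X.K.d (i + 1) (i + 2) ≫ g = f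
  exact_co_first : ∀ (T : 𝒞) (f : A ⟶ T),
    push f δ = 0 ↔ ∃ g : X.K.X 1 ⟶ T, X.dFirst ≫ g = f

variable (𝔼) in
/-- A correspondence `𝔰` that associates a homotopy equivalence class `𝔰(δ) = [X]` of complexes
from `A` to `C` to each extension `δ ∈ 𝔼(C, A)`. -/
abbrev Correspondence (n : ℕ) := ∀ ⦃A C : 𝒞⦄, Ext 𝔼 C A → HtpyClass n A C

variable {n : ℕ} (𝔰 : Correspondence 𝔼 n)

/-- `X` realizes `δ`, that is, `𝔰(δ) = [X]`. -/
def Realizes {A C : 𝒞} (X : CpxBetween n A C) (δ : Ext 𝔼 C A) : Prop := 𝔰 δ = ⟦X⟧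

/-- `𝔰` is an exact realization of `𝔼`. -/
structure IsExactRealization : Prop where
  /-- (R0): morphisms of extensions lift. -/
  lift : ∀ {A C A' C' : 𝒞} (δ : Ext 𝔼 C A) (ρ : Ext 𝔼 C' A') (X : CpxBetween n A C)
    (Y : CpxBetween n A' C'), Realizes 𝔰 X δ → Realizes 𝔰 Y ρ →
    ∀ (a : A ⟶ A') (c : C ⟶ C'), push a δ = pull c ρ → ∃ f : X.K ⟶ Y.K, X.HasEnds Y f a c
  /-- (R1): realizations of extensions are `n`-exangles. -/
  exangle : ∀ {A C : 𝒞} (δ : Ext 𝔼 C A) (X : CpxBetween n A C), Realizes 𝔰 X δ → IsExangle X δ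
  /-- (R2): the zero extension in `𝔼(0, A)` is realized by `A = A ⟶ 0 ⟶ ⋯ ⟶ 0`. -/
  zero_right : ∀ {A Z : 𝒞} (X : CpxBetween n A Z), IsZero Z → IsIso (X.K.d 0 1) →
    (∀ i, 2 ≤ i → IsZero (X.K.X i)) → Realizes 𝔰 X (0 : Ext 𝔼 Z A)
  /-- (R2), dual part: the zero extension in `𝔼(A, 0)` is realized by `0 ⟶ ⋯ ⟶ 0 ⟶ A = A`. -/
  zero_left : ∀ {A Z : 𝒞} (X : CpxBetween n Z A), IsZero Z → IsIso (X.K.d n (n + 1)) →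
    (∀ i, i < n → IsZero (X.K.X i)) → Realizes 𝔰 X (0 : Ext 𝔼 A Z)

/-- `f` is an `𝔰`-inflation: it is the morphism `d⁰` of some conflation. -/
def IsInflation {A B : 𝒞} (f : A ⟶ B) : Prop :=
  ∃ (C : 𝒞) (δ : Ext 𝔼 C A) (X : CpxBetween n A C),
    Realizes 𝔰 X δ ∧ ∃ e : X.K.X 1 ≅ B, X.dFirst ≫ e.hom = f

/-- `g` is an `𝔰`-deflation: it is the morphism `dⁿ` of some conflation. -/
def IsDeflation {B C : 𝒞} (g : B ⟶ C) : Prop :=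
  ∃ (A : 𝒞) (δ : Ext 𝔼 C A) (X : CpxBetween n A C),
    Realizes 𝔰 X δ ∧ ∃ e : B ≅ X.K.X n, e.hom ≫ X.dLast = g

/-- `(𝒞, 𝔼, 𝔰)` is an `n`-exangulated category. -/
structure IsNExangulated [HasZeroObject 𝒞] [HasBinaryBiproducts 𝒞] : Prop extends IsExactRealization 𝔰 where
  /-- (EA1): inflations compose. -/
  inflation_comp : ∀ {A B C : 𝒞} (f : A ⟶ B) (g : B ⟶ C),
    IsInflation 𝔰 f → IsInflation 𝔰 g → IsInflation 𝔰 (f ≫ g)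
  /-- (EA1): deflations compose. -/
  deflation_comp : ∀ {A B C : 𝒞} (f : A ⟶ B) (g : B ⟶ C),
    IsDeflation 𝔰 f → IsDeflation 𝔰 g → IsDeflation 𝔰 (f ≫ g)
  /-- (EA2): `(𝟙 A, c)` has a good lift. -/
  good_lift : ∀ {A C D : 𝒞} (ρ : Ext 𝔼 D A) (c : C ⟶ D) (X : CpxBetween n A C)
    (Y : CpxBetween n A D), Realizes 𝔰 X (pull c ρ) → Realizes 𝔰 Y ρ →
    ∃ f : X.K ⟶ Y.K, X.HasEnds Y f (𝟙 A) c ∧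
      Realizes 𝔰 (mappingCone X Y f) (push X.dFirst ρ)
  /-- (EA2ᵒᵖ): `(a, 𝟙 C)` has a good lift. -/
  good_lift_op : ∀ {A B C : 𝒞} (ρ : Ext 𝔼 C A) (a : A ⟶ B) (X : CpxBetween n A C)
    (Y : CpxBetween n B C), Realizes 𝔰 X ρ → Realizes 𝔰 Y (push a ρ) →
    ∃ h : X.K ⟶ Y.K, X.HasEnds Y h a (𝟙 C) ∧
      Realizes 𝔰 (mappingCocone X Y h) (pull Y.dLast ρ)

/-! ### Projectives and injectives, stable categories -/

/-- The projective objects of `(𝒞, 𝔼, 𝔰)`. -/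
def IsProjective : ObjectProperty 𝒞 := fun P =>
  ∀ (A C : 𝒞) (δ : Ext 𝔼 C A) (X : CpxBetween n A C), Realizes 𝔰 X δ →
    ∀ c : P ⟶ C, ∃ b : P ⟶ X.K.X n, b ≫ X.dLast = c

/-- The injective objects of `(𝒞, 𝔼, 𝔰)`. -/
def IsInjective : ObjectProperty 𝒞 := fun I =>
  ∀ (A C : 𝒞) (δ : Ext 𝔼 C A) (X : CpxBetween n A C), Realizes 𝔰 X δ →
    ∀ a : A ⟶ I, ∃ b : X.K.X 1 ⟶ I, X.dFirst ≫ b = a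

/-- `(𝒞, 𝔼, 𝔰)` has enough projectives. -/
def EnoughProjectives : Prop :=
  ∀ C : 𝒞, ∃ (A : 𝒞) (δ : Ext 𝔼 C A) (X : CpxBetween n A C), Realizes 𝔰 X δ ∧
    ∀ i, 1 ≤ i → i ≤ n → IsProjective 𝔰 (X.K.X i)

/-- `(𝒞, 𝔼, 𝔰)` has enough injectives. -/
def EnoughInjectives : Prop :=
  ∀ A : 𝒞, ∃ (C : 𝒞) (δ : Ext 𝔼 C A) (X : CpxBetween n A C), Realizes 𝔰 X δ ∧
    ∀ i, 1 ≤ i → i ≤ n → IsInjective 𝔰 (X.K.X i)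

/-- The projectively stable category of `𝒞`, the quotient of `𝒞` by the projectives. -/
abbrev ProjStable := IdealQuotient (IsProjective 𝔰)

/-- The injectively stable (costable) category of `𝒞`, the quotient of `𝒞` by the injectives. -/
abbrev InjStable := IdealQuotient (IsInjective 𝔰)

/-! ### The category of deflations -/

/-- The `𝔰`-deflations, as a property of the objects of the morphism category of `𝒞`. -/
def deflations : ObjectProperty (Arrow 𝒞) := fun g => IsDeflation 𝔰 g.hom

/-- The full subcategory `𝔰-def 𝒞` of the morphism category that consists of the deflations. -/
abbrev SDef := (deflations 𝔰).FullSubcategory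

/-- The deflations that are split epimorphisms. -/
def splitEpis : ObjectProperty (SDef 𝔰) := fun g => IsSplitEpi g.obj.hom

/-- The quotient category `𝔰-def 𝒞 / [s-epi 𝒞]`. -/
abbrev SDefQuotient := IdealQuotient (splitEpis 𝔰)

/-! ### Distinguished `n`-exangles and defects -/

/-- The distinguished `n`-exangles `⟨X, δ⟩`. -/
structure DistExangle where
  cpx : Cpx 𝒞 n
  δ : Ext 𝔼 (cpx.K.X (n + 1)) (cpx.K.X 0)
  realizes : Realizes 𝔰 cpx.between δ

namespace DistExangle

variable {𝔰}

/-- A morphism `⟨X, δ⟩ ⟶ ⟨Y, ρ⟩` of distinguished `n`-exangles: a morphism `f` of complexes with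
`(f⁰)_* δ = (fⁿ⁺¹)^* ρ`. -/
@[ext]
structure Hom (X Y : DistExangle 𝔰) where
  f : X.cpx.K ⟶ Y.cpx.K
  comm : push (f.f 0) X.δ = pull (f.f (n + 1)) Y.δ

lemma push_pull {C C' A A' : 𝒞} (a : A ⟶ A') (c : C' ⟶ C) (δ : Ext 𝔼 C A) :
    push a (pull c δ) = pull c (push a δ) :=
  (ConcreteCategory.congr_hom ((𝔼.map c.op).naturality a) δ).symm

instance : Category (DistExangle 𝔰) where
  Hom X Y := Hom X Y
  id X := ⟨𝟙 _, by simp [push, pull]⟩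
  comp {X Y Z} f g := ⟨f.f ≫ g.f, by
    have h₁ : push ((f.f ≫ g.f).f 0) X.δ = push (g.f.f 0) (push (f.f.f 0) X.δ) := by
      simp [push]
    have h₂ : pull ((f.f ≫ g.f).f (n + 1)) Z.δ
        = pull (f.f.f (n + 1)) (pull (g.f.f (n + 1)) Z.δ) := by
      simp [pull]
    rw [h₁, h₂, f.comm, push_pull, g.comm]⟩
  id_comp f := Hom.ext (Category.id_comp _)
  comp_id f := Hom.ext (Category.comp_id _)
  assoc f g h := Hom.ext (Category.assoc _ _ _)

variable (𝔰)

/-- The functor that sends a distinguished `n`-exangle `⟨X, δ⟩` to its deflation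
`dⁿ : Xⁿ ⟶ Xⁿ⁺¹`. -/
def deflation : DistExangle 𝔰 ⥤ SDef 𝔰 where
  obj X := ⟨Arrow.mk (X.cpx.K.d n (n + 1)), X.cpx.K.X 0, X.δ, X.cpx.between, X.realizes,
    Iso.refl _, by simp [CpxBetween.dLast, Cpx.between]⟩
  map f := ObjectProperty.homMk (Arrow.homMk (f.f.f n) (f.f.f (n + 1)) (by simp))
  map_id X := rfl
  map_comp f g := rfl

/-- The contravariant functor that sends a distinguished `n`-exangle `⟨X, δ⟩` to its inflation
`d⁰ : X⁰ ⟶ X¹`, as a morphism of the opposite category of `𝒞`. -/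
def inflationOp : (DistExangle 𝔰)ᵒᵖ ⥤ Arrow 𝒞ᵒᵖ where
  obj X := Arrow.mk (X.unop.cpx.K.d 0 1).op
  map f := Arrow.homMk (f.unop.f.f 1).op (f.unop.f.f 0).op (by simp [← op_comp])
  map_id X := rfl
  map_comp f g := rfl

end DistExangle

/-- The contravariant defect of a deflation `g : B ⟶ C`, i.e. the cokernel of
`𝒞(-, B) ⟶ 𝒞(-, C)`, as a functor in `g`. -/
def contravariantDefect : SDef 𝔰 ⥤ RightMod 𝒞 :=
  (deflations 𝔰).ι ⋙ (preadditiveYoneda (C := 𝒞)).mapArrow ⋙ coker _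

/-- The covariant defect of a distinguished `n`-exangle `⟨X, δ⟩`, i.e. the cokernel of
`𝒞(X¹, -) ⟶ 𝒞(X⁰, -)`, as a (contravariant) functor in `⟨X, δ⟩`. It is a covariant functor on
`𝒞`, i.e. a right module over the opposite category of `𝒞`. -/
def covariantDefect : (DistExangle 𝔰)ᵒᵖ ⥤ RightMod 𝒞ᵒᵖ :=
  DistExangle.inflationOp 𝔰 ⋙ (preadditiveYoneda (C := 𝒞ᵒᵖ)).mapArrow ⋙ coker _

/-- A module over the projectively stable category of `𝒞`, viewed as a module over `𝒞` by
composition with the projection. -/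
def restrictProjStable : FPMod (ProjStable 𝔰) ⥤ RightMod 𝒞 :=
  (IsFinitelyPresented (𝒜 := ProjStable 𝔰)).ι ⋙
    (Functor.whiskeringLeft _ _ _).obj (toQuotient (IsProjective 𝔰)).op

/-- A module over the opposite of the injectively stable category of `𝒞`, viewed as a module over
the opposite of `𝒞` by composition with the projection. -/
def restrictInjStable : FPMod (InjStable 𝔰)ᵒᵖ ⥤ RightMod 𝒞ᵒᵖ :=
  (IsFinitelyPresented (𝒜 := (InjStable 𝔰)ᵒᵖ)).ι ⋙
    (Functor.whiskeringLeft _ _ _).obj (toQuotient (IsInjective 𝔰)).op.op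

end Exangulated

end

end NExangulated

/-!
A finitely presented module is a cokernel of a morphism `𝒜(-, X) ⟶ 𝒜(-, Y)`, and since
representable modules are projective, morphisms of such cokernels are commutative squares, where a
square vanishes if and only if its morphism of targets factors through the second arrow
(`exists_fpCoker_map`, `fpCoker_map_eq_iff`). In `𝔰-def 𝒞` a square between deflations lies in
`[s-epi 𝒞]` under the very same condition (`mem_ideal_splitEpis_iff`). It therefore remains to
compare deflations in `𝒞` with arbitrary morphisms of the stable category.

* A morphism into the target of a deflation that factors through a projective factors through
  the deflation, so the contravariant defect of a deflation does not see the difference between `𝒞`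
  and the stable category.
* If `p : P ⟶ Y` is a deflation with `P` projective, then `[f, p] : X ⊞ P ⟶ Y` is a deflation for
  every `f : X ⟶ Y`, as the last morphism of the mapping cone in (EA2), and it agrees with `f`
  stably. So every finitely presented module is a defect.
* A deflation `dⁿ` has the weak kernel `dⁿ⁻¹`, hence the stable category has weak kernels, and
  `mod` is abelian by Freyd's theorem (`isAbelianCategory_fpMod`).

These facts are isolated in `IsDefectSetting`. They hold for inflations in the opposite category as
well, with injectives in place of projectives. To pass between inflations and deflations, both are
seen as quotients of a category of extensions with chosen realizations (`RealizedExt`). Every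
square between inflations, or between deflations, comes from a morphism of extensions, because
`𝒞(C', C) ⟶ 𝔼(C', A) ⟶ 𝔼(C', X¹)` and its dual are exact (`exists_pull_eq`, `exists_push_eq`); and
for a morphism `(a, c) : δ ⟶ ρ` of extensions, `c` factors through the deflation of `ρ` if and only
if `c^* ρ = a_* δ` vanishes, if and only if `a` factors through the inflation of `δ`.

An equivalence between additive categories transports being abelian and is automatically additive
(`IsAbelianCategory.of_equivalence`).
-/

namespace NExangulated

noncomputable section

/-! ### Presentations and Freyd's theorem -/

section Presentations

variable {𝒜 : Type u} [Category.{v} 𝒜] [Preadditive 𝒜]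

/-- Exactness of `𝒜(-, X) ⟶ 𝒜(-, Y) ⟶ F ⟶ 0`, where the first morphism is induced by `f`,
expressed in terms of elements. -/
structure IsPresentation {X Y : 𝒜} (f : X ⟶ Y) {F : RightMod 𝒜}
    (p : preadditiveYoneda.obj Y ⟶ F) : Prop where
  surj : ∀ (T : 𝒜) (x : F.obj (op T)), ∃ t : T ⟶ Y, p.app (op T) t = x
  ker : ∀ (T : 𝒜) (t : T ⟶ Y), p.app (op T) t = 0 ↔ ∃ s : T ⟶ X, s ≫ f = t

lemma yoneda_app_eq {Y : 𝒜} {F : RightMod 𝒜} (p : preadditiveYoneda.obj Y ⟶ F) {T : 𝒜}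
    (t : T ⟶ Y) : p.app (op T) t = F.map t.op (p.app (op Y) (𝟙 Y)) := by
  have h := ConcreteCategory.congr_hom (p.naturality t.op) (𝟙 Y)
  refine Eq.trans ?_ h
  change _ = p.app (op T) (t ≫ 𝟙 Y)
  rw [Category.comp_id]

lemma yoneda_app_sub {Y : 𝒜} {F : RightMod 𝒜} (p : preadditiveYoneda.obj Y ⟶ F) {T : 𝒜}
    (t t' : T ⟶ Y) : p.app (op T) (t - t' : T ⟶ Y) = p.app (op T) t - p.app (op T) t' :=
  map_sub (p.app (op T)).hom t t'

lemma yoneda_app_add {Y : 𝒜} {F : RightMod 𝒜} (p : preadditiveYoneda.obj Y ⟶ F) {T : 𝒜}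
    (t t' : T ⟶ Y) : p.app (op T) (t + t' : T ⟶ Y) = p.app (op T) t + p.app (op T) t' :=
  map_add (p.app (op T)).hom t t'

lemma yoneda_hom_ext {Y : 𝒜} {F : RightMod 𝒜} {p q : preadditiveYoneda.obj Y ⟶ F}
    (h : p.app (op Y) (𝟙 Y) = q.app (op Y) (𝟙 Y)) : p = q := by
  ext ⟨T⟩ t
  exact (yoneda_app_eq p t).trans ((congrArg (F.map t.op) h).trans (yoneda_app_eq q t).symm)

/-- Representable modules are projective: a morphism into a presented module lifts. -/
lemma IsPresentation.exists_lift {X Y Z : 𝒜} {f : X ⟶ Y} {F : RightMod 𝒜}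
    {p : preadditiveYoneda.obj Y ⟶ F} (hp : IsPresentation f p)
    (q : preadditiveYoneda.obj Z ⟶ F) : ∃ t : Z ⟶ Y, preadditiveYoneda.map t ≫ p = q := by
  obtain ⟨t, ht⟩ := hp.surj Z (q.app (op Z) (𝟙 Z))
  refine ⟨t, yoneda_hom_ext (Eq.trans ?_ ht)⟩
  change p.app (op Z) (𝟙 Z ≫ t) = _
  rw [Category.id_comp]

omit [Preadditive 𝒜] in
lemma isIso_of_bijective {F G : 𝒜ᵒᵖ ⥤ AddCommGrpCat.{v}} (α : F ⟶ G)
    (inj : ∀ (T : 𝒜) (x : F.obj (op T)), α.app (op T) x = 0 → x = 0)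
    (surj : ∀ (T : 𝒜) (x : G.obj (op T)), ∃ y, α.app (op T) y = x) : IsIso α := by
  rw [NatTrans.isIso_iff_isIso_app]
  rintro ⟨T⟩
  rw [ConcreteCategory.isIso_iff_bijective]
  refine ⟨fun x y h => ?_, surj T⟩
  have h' := inj T (x - y) (by
    refine (map_sub (α.app (op T)).hom x y).trans ?_
    exact sub_eq_zero.2 h)
  exact sub_eq_zero.1 h'

lemma isPresentation_of_isColimit {X Y : 𝒜} {f : X ⟶ Y} {F : RightMod 𝒜}
    {p : preadditiveYoneda.obj Y ⟶ F} (w : preadditiveYoneda.map f ≫ p = 0)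
    (h : IsColimit (CokernelCofork.ofπ p w)) : IsPresentation f p := by
  obtain ⟨h₁, h₂⟩ := (ShortComplex.mk _ p w).exact_and_epi_g_iff_g_is_cokernel.2 ⟨h⟩
  dsimp at h₂
  refine ⟨fun T x => ?_, fun T t => ⟨fun ht => ?_, ?_⟩⟩
  · exact (AddCommGrpCat.epi_iff_surjective (p.app (op T))).1 inferInstance x
  · have h₃ := h₁.map ((evaluation 𝒜ᵒᵖ AddCommGrpCat.{v}).obj (op T))
    rw [ShortComplex.ab_exact_iff] at h₃
    exact h₃ t ht
  · rintro ⟨s, rfl⟩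
    exact ConcreteCategory.congr_hom (NatTrans.congr_app w (op T)) s

lemma isPresentation_cokernel {X Y : 𝒜} (f : X ⟶ Y) :
    IsPresentation f (cokernel.π (preadditiveYoneda.map f)) :=
  isPresentation_of_isColimit (cokernel.condition _) (cokernelIsCokernel _)

lemma IsPresentation.condition {X Y : 𝒜} {f : X ⟶ Y} {F : RightMod 𝒜}
    {p : preadditiveYoneda.obj Y ⟶ F} (hp : IsPresentation f p) :
    preadditiveYoneda.map f ≫ p = 0 := by
  ext ⟨T⟩ s
  exact (hp.ker T _).2 ⟨s, rfl⟩

lemma IsPresentation.isIso_desc {X Y : 𝒜} {f : X ⟶ Y} {F : RightMod 𝒜}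
    {p : preadditiveYoneda.obj Y ⟶ F} (hp : IsPresentation f p) :
    IsIso (cokernel.desc (preadditiveYoneda.map f) p hp.condition) := by
  have h : ∀ (T : 𝒜) (t : T ⟶ Y), (cokernel.desc (preadditiveYoneda.map f) p hp.condition).app
      (op T) ((cokernel.π (preadditiveYoneda.map f)).app (op T) t) = p.app (op T) t := fun T t =>
    ConcreteCategory.congr_hom
      (NatTrans.congr_app (cokernel.π_desc (preadditiveYoneda.map f) p hp.condition) (op T)) t
  refine isIso_of_bijective _ (fun T x hx => ?_) (fun T x => ?_)
  · obtain ⟨t, rfl⟩ := (isPresentation_cokernel f).surj T x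
    rw [h] at hx
    exact ((isPresentation_cokernel f).ker T t).2 ((hp.ker T t).1 hx)
  · obtain ⟨t, rfl⟩ := hp.surj T x
    exact ⟨_, h T t⟩

lemma IsPresentation.isFinitelyPresented {X Y : 𝒜} {f : X ⟶ Y} {F : RightMod 𝒜}
    {p : preadditiveYoneda.obj Y ⟶ F} (hp : IsPresentation f p) : IsFinitelyPresented F := by
  have := hp.isIso_desc
  exact ⟨X, Y, preadditiveYoneda.map f, p, hp.condition,
    ⟨IsColimit.ofIsoColimit (cokernelIsCokernel _)
      (Cofork.ext (asIso (cokernel.desc (preadditiveYoneda.map f) p hp.condition)) (by simp))⟩⟩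

lemma isFinitelyPresented_iff (F : RightMod 𝒜) : IsFinitelyPresented F ↔
    ∃ (X Y : 𝒜) (f : X ⟶ Y) (p : preadditiveYoneda.obj Y ⟶ F), IsPresentation f p := by
  refine ⟨?_, fun ⟨_, _, _, _, h⟩ => h.isFinitelyPresented⟩
  rintro ⟨X, Y, φ, p, hp, ⟨h⟩⟩
  obtain ⟨f, rfl⟩ := preadditiveYoneda.map_surjective φ
  exact ⟨X, Y, f, p, isPresentation_of_isColimit hp h⟩

lemma IsPresentation.of_isIso {X Y : 𝒜} {f : X ⟶ Y} {F G : RightMod 𝒜}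
    {p : preadditiveYoneda.obj Y ⟶ F} (hp : IsPresentation f p) (α : F ⟶ G) [IsIso α] :
    IsPresentation f (p ≫ α) := by
  have hα := fun T => (ConcreteCategory.isIso_iff_bijective (α.app (op T))).1 inferInstance
  refine ⟨fun T x => ?_, fun T t => ?_⟩
  · obtain ⟨y, rfl⟩ := (hα T).2 x
    obtain ⟨t, rfl⟩ := hp.surj T y
    exact ⟨t, rfl⟩
  · rw [← hp.ker]
    refine ⟨fun h => (hα T).1 (Eq.trans h (map_zero (α.app (op T)).hom).symm), fun h => ?_⟩
    exact (congrArg (α.app (op T)) h).trans (map_zero (α.app (op T)).hom)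

instance : (IsFinitelyPresented (𝒜 := 𝒜)).IsClosedUnderIsomorphisms where
  of_iso e h := by
    rw [isFinitelyPresented_iff] at h ⊢
    obtain ⟨X, Y, f, p, hp⟩ := h
    exact ⟨X, Y, f, _, hp.of_isIso e.hom⟩

end Presentations

section Freyd

variable {𝒜 : Type u} [Category.{v} 𝒜] [Preadditive 𝒜]

variable (𝒜) in
/-- Every morphism `f` has a weak kernel: a morphism `k` with `k ≫ f = 0` through which every `t`
with `t ≫ f = 0` factors, not necessarily in a unique way. -/
def WeakKernelsExist : Prop :=
  ∀ ⦃X Y : 𝒜⦄ (f : X ⟶ Y), ∃ (K : 𝒜) (k : K ⟶ X), k ≫ f = 0 ∧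
    ∀ ⦃T : 𝒜⦄ (t : T ⟶ X), t ≫ f = 0 → ∃ s : T ⟶ K, s ≫ k = t

lemma isFinitelyPresented_of_isZero [HasZeroObject 𝒜] {F : RightMod 𝒜} (hF : IsZero F) :
    IsFinitelyPresented F := by
  have h₀ : ∀ (T : 𝒜) (x : F.obj (op T)), x = 0 := fun T x =>
    ConcreteCategory.congr_hom (NatTrans.congr_app (hF.eq_of_src (𝟙 _) 0) (op T)) x
  obtain ⟨Z, hZ⟩ := HasZeroObject.zero (C := 𝒜)
  exact IsPresentation.isFinitelyPresented (f := 𝟙 Z) (p := 0)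
    ⟨fun T x => ⟨0, (h₀ T _).trans (h₀ T _).symm⟩,
      fun T t => ⟨fun _ => ⟨t, hZ.eq_of_tgt _ _⟩, fun _ => h₀ T _⟩⟩

variable [HasBinaryBiproducts 𝒜]

/-- The weak pullback of `f` and `g`, of which only the projection to the source of `f` is kept. -/
lemma exists_weakPullback (h𝒜 : WeakKernelsExist 𝒜) {X Y Z : 𝒜} (f : X ⟶ Z) (g : Y ⟶ Z) :
    ∃ (W : 𝒜) (p : W ⟶ X), ∀ ⦃T : 𝒜⦄ (t : T ⟶ X),
      (∃ s : T ⟶ W, s ≫ p = t) ↔ ∃ u : T ⟶ Y, u ≫ g = t ≫ f := by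
  obtain ⟨W, k, hk, h⟩ := h𝒜 (biprod.desc f (-g))
  refine ⟨W, k ≫ biprod.fst, fun T t => ⟨?_, ?_⟩⟩
  · rintro ⟨s, rfl⟩
    refine ⟨s ≫ k ≫ biprod.snd, ?_⟩
    have h₁ : k ≫ biprod.fst ≫ f - k ≫ biprod.snd ≫ g = 0 := by
      simpa [biprod.desc_eq, sub_eq_add_neg] using hk
    simp [sub_eq_zero.1 h₁]
  · rintro ⟨u, hu⟩
    obtain ⟨s, hs⟩ := h (biprod.lift t u) (by simp [hu])
    exact ⟨s, by simp [reassoc_of% hs]⟩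

/-- The generators of the kernel are a weak pullback of the generators of `F` and the relations of
`G`, and its relations are a weak pullback of these and the relations of `F`. -/
lemma isFinitelyPresented_kernel (h𝒜 : WeakKernelsExist 𝒜) {F G K : RightMod 𝒜} (α : F ⟶ G)
    (ι : K ⟶ F) (w : ι ≫ α = 0) (hι : IsLimit (KernelFork.ofι ι w))
    (hF : IsFinitelyPresented F) (hG : IsFinitelyPresented G) : IsFinitelyPresented K := by
  obtain ⟨X₁, X₀, f, p, hp⟩ := (isFinitelyPresented_iff F).1 hF
  obtain ⟨Y₁, Y₀, g, q, hq⟩ := (isFinitelyPresented_iff G).1 hG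
  obtain ⟨a, ha⟩ := hq.exists_lift (p ≫ α)
  have ha' : ∀ (T : 𝒜) (t : T ⟶ X₀), α.app (op T) (p.app (op T) t) = q.app (op T) (t ≫ a) :=
    fun T t => (ConcreteCategory.congr_hom (NatTrans.congr_app ha (op T)) t).symm
  obtain ⟨W, k, hk⟩ := exists_weakPullback h𝒜 a g
  obtain ⟨V, r, hr⟩ := exists_weakPullback h𝒜 k f
  have hinj : ∀ (T : 𝒜) (x : K.obj (op T)), ι.app (op T) x = 0 → x = 0 := fun T x hx => by
    have : Mono ι := Fork.IsLimit.mono hι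
    refine (AddCommGrpCat.mono_iff_injective (ι.app (op T))).1 inferInstance ?_
    exact hx.trans (map_zero (ι.app (op T)).hom).symm
  -- the composite of `k` and `p` lands in the kernel
  have hw : (preadditiveYoneda.map k ≫ p) ≫ α = 0 := by
    refine yoneda_hom_ext ?_
    refine (ha' W (𝟙 W ≫ k)).trans ((hq.ker W _).2 ?_)
    exact (hk _).1 ⟨𝟙 W, rfl⟩
  obtain ⟨l, hl⟩ := KernelFork.IsLimit.lift' hι _ hw
  have hl' : ∀ (T : 𝒜) (t : T ⟶ W), ι.app (op T) (l.app (op T) t) = p.app (op T) (t ≫ k) :=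
    fun T t => ConcreteCategory.congr_hom (NatTrans.congr_app hl (op T)) t
  refine IsPresentation.isFinitelyPresented (f := r) (p := l) ⟨fun T x => ?_, fun T t => ?_⟩
  · obtain ⟨t, ht⟩ := hp.surj T (ι.app (op T) x)
    have h₀ : α.app (op T) (ι.app (op T) x) = 0 :=
      ConcreteCategory.congr_hom (NatTrans.congr_app w (op T)) x
    rw [← ht, ha', hq.ker] at h₀
    obtain ⟨s, rfl⟩ := (hk t).2 h₀
    refine ⟨s, sub_eq_zero.1 (hinj T _ ?_)⟩
    refine (map_sub (ι.app (op T)).hom _ _).trans (sub_eq_zero.2 ?_)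
    exact (hl' T s).trans ht
  · rw [hr, ← hp.ker, ← hl']
    refine ⟨fun h => ?_, hinj T _⟩
    exact (congrArg (ι.app (op T)) h).trans (map_zero (ι.app (op T)).hom)

lemma isFinitelyPresented_cokernel {F G C : RightMod 𝒜} (α : F ⟶ G)
    (π : G ⟶ C) (w : α ≫ π = 0) (hπ : IsColimit (CokernelCofork.ofπ π w))
    (hF : IsFinitelyPresented F) (hG : IsFinitelyPresented G) : IsFinitelyPresented C := by
  obtain ⟨X₁, X₀, f, p, hp⟩ := (isFinitelyPresented_iff F).1 hF
  obtain ⟨Y₁, Y₀, g, q, hq⟩ := (isFinitelyPresented_iff G).1 hG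
  obtain ⟨a, ha⟩ := hq.exists_lift (p ≫ α)
  have ha' : ∀ (T : 𝒜) (t : T ⟶ X₀), α.app (op T) (p.app (op T) t) = q.app (op T) (t ≫ a) :=
    fun T t => (ConcreteCategory.congr_hom (NatTrans.congr_app ha (op T)) t).symm
  obtain ⟨h₁, h₂⟩ := (ShortComplex.mk α π w).exact_and_epi_g_iff_g_is_cokernel.2 ⟨hπ⟩
  dsimp at h₂
  refine IsPresentation.isFinitelyPresented (f := biprod.desc g a) (p := q ≫ π)
    ⟨fun T x => ?_, fun T t => ⟨fun h => ?_, ?_⟩⟩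
  · obtain ⟨y, rfl⟩ := (AddCommGrpCat.epi_iff_surjective (π.app (op T))).1 inferInstance x
    obtain ⟨t, rfl⟩ := hq.surj T y
    exact ⟨t, rfl⟩
  · have h₃ := h₁.map ((evaluation 𝒜ᵒᵖ AddCommGrpCat.{v}).obj (op T))
    rw [ShortComplex.ab_exact_iff] at h₃
    obtain ⟨x, hx⟩ := h₃ (q.app (op T) t) h
    obtain ⟨s, rfl⟩ := hp.surj T x
    replace hx : α.app (op T) (p.app (op T) s) = q.app (op T) t := hx
    rw [ha'] at hx
    obtain ⟨u, hu⟩ := (hq.ker T (t - s ≫ a)).1 (by rw [yoneda_app_sub, hx, sub_self])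
    exact ⟨biprod.lift u s, by simp [hu]⟩
  · rintro ⟨s, rfl⟩
    have h₃ : ∀ x, π.app (op T) (α.app (op T) x) = 0 :=
      ConcreteCategory.congr_hom (NatTrans.congr_app w (op T))
    have h₄ : s ≫ biprod.desc g a = (s ≫ biprod.fst) ≫ g + (s ≫ biprod.snd) ≫ a := by
      simp [biprod.desc_eq]
    rw [h₄, yoneda_app_add]
    refine (congrArg₂ (· + ·) ?_ ?_).trans (add_zero 0)
    · exact (congrArg (π.app (op T)) ((hq.ker T _).2 ⟨_, rfl⟩)).trans
        (map_zero (π.app (op T)).hom)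
    · exact (congrArg (π.app (op T)) (ha' T _).symm).trans (h₃ _)

lemma isFinitelyPresented_biprod {F G : RightMod 𝒜}
    (hF : IsFinitelyPresented F) (hG : IsFinitelyPresented G) : IsFinitelyPresented (F ⊞ G) := by
  obtain ⟨X₁, X₀, f, p, hp⟩ := (isFinitelyPresented_iff F).1 hF
  obtain ⟨Y₁, Y₀, g, q, hq⟩ := (isFinitelyPresented_iff G).1 hG
  let r : preadditiveYoneda.obj (X₀ ⊞ Y₀) ⟶ F ⊞ G :=
    biprod.lift (preadditiveYoneda.map biprod.fst ≫ p) (preadditiveYoneda.map biprod.snd ≫ q)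
  have h₁ : ∀ (T : 𝒜) (t : T ⟶ X₀ ⊞ Y₀), (biprod.fst : F ⊞ G ⟶ F).app (op T) (r.app (op T) t) =
      p.app (op T) (t ≫ biprod.fst) := fun T t =>
    ConcreteCategory.congr_hom (NatTrans.congr_app (biprod.lift_fst
      (preadditiveYoneda.map biprod.fst ≫ p) (preadditiveYoneda.map biprod.snd ≫ q)) (op T)) t
  have h₂ : ∀ (T : 𝒜) (t : T ⟶ X₀ ⊞ Y₀), (biprod.snd : F ⊞ G ⟶ G).app (op T) (r.app (op T) t) =
      q.app (op T) (t ≫ biprod.snd) := fun T t =>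
    ConcreteCategory.congr_hom (NatTrans.congr_app (biprod.lift_snd
      (preadditiveYoneda.map biprod.fst ≫ p) (preadditiveYoneda.map biprod.snd ≫ q)) (op T)) t
  have h₃ : ∀ (T : 𝒜) (x y : (F ⊞ G).obj (op T)),
      (biprod.fst : F ⊞ G ⟶ F).app (op T) x = (biprod.fst : F ⊞ G ⟶ F).app (op T) y →
      (biprod.snd : F ⊞ G ⟶ G).app (op T) x = (biprod.snd : F ⊞ G ⟶ G).app (op T) y → x = y := by
    intro T x y hx hy
    have h := fun z => ConcreteCategory.congr_hom
      (NatTrans.congr_app (biprod.total (X := F) (Y := G)) (op T)) z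
    rw [← show _ = x from h x, ← show _ = y from h y]
    exact congrArg₂ (· + ·) (congrArg ((biprod.inl : F ⟶ F ⊞ G).app (op T)) hx)
      (congrArg ((biprod.inr : G ⟶ F ⊞ G).app (op T)) hy)
  refine IsPresentation.isFinitelyPresented (f := biprod.map f g) (p := r)
    ⟨fun T x => ?_, fun T t => ⟨fun h => ?_, ?_⟩⟩
  · obtain ⟨s, hs⟩ := hp.surj T ((biprod.fst : F ⊞ G ⟶ F).app (op T) x)
    obtain ⟨t, ht⟩ := hq.surj T ((biprod.snd : F ⊞ G ⟶ G).app (op T) x)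
    refine ⟨biprod.lift s t, h₃ T _ _ ?_ ?_⟩
    · rw [h₁, biprod.lift_fst, hs]
    · rw [h₂, biprod.lift_snd, ht]
  · obtain ⟨a, ha⟩ := (hp.ker T (t ≫ biprod.fst)).1 (by
      rw [← h₁, h]; exact map_zero ((biprod.fst : F ⊞ G ⟶ F).app (op T)).hom)
    obtain ⟨b, hb⟩ := (hq.ker T (t ≫ biprod.snd)).1 (by
      rw [← h₂, h]; exact map_zero ((biprod.snd : F ⊞ G ⟶ G).app (op T)).hom)
    exact ⟨biprod.lift a b, by apply biprod.hom_ext <;> simp [ha, hb]⟩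
  · rintro ⟨s, rfl⟩
    refine h₃ T _ _ ?_ ?_
    · rw [h₁]
      exact ((hp.ker T _).2 ⟨s ≫ biprod.fst, by simp⟩).trans
        (map_zero ((biprod.fst : F ⊞ G ⟶ F).app (op T)).hom).symm
    · rw [h₂]
      exact ((hq.ker T _).2 ⟨s ≫ biprod.snd, by simp⟩).trans
        (map_zero ((biprod.snd : F ⊞ G ⟶ G).app (op T)).hom).symm

variable [HasZeroObject 𝒜]

/-- Freyd's theorem: if `𝒜` has weak kernels, then `mod 𝒜` is abelian. It is closed under
kernels, cokernels and finite products in the category of all modules. -/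
theorem isAbelianCategory_fpMod (h𝒜 : WeakKernelsExist 𝒜) : IsAbelianCategory (FPMod 𝒜) := by
  have : (IsFinitelyPresented (𝒜 := 𝒜)).ContainsZero := 
    ⟨_, isZero_zero _, isFinitelyPresented_of_isZero (isZero_zero _)⟩
  have : (IsFinitelyPresented (𝒜 := 𝒜)).IsClosedUnderKernels := ⟨by
    rintro _ ⟨f, k, hk, hf⟩
    exact isFinitelyPresented_kernel h𝒜 f k.ι k.condition
      (IsLimit.ofIsoLimit hk (Fork.ext (Iso.refl _))) hf.1 hf.2⟩
  have : (IsFinitelyPresented (𝒜 := 𝒜)).IsClosedUnderCokernels := ⟨by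
    rintro _ ⟨f, k, hk, hf⟩
    exact isFinitelyPresented_cokernel f k.π k.condition
      (IsColimit.ofIsoColimit hk (Cofork.ext (Iso.refl _))) hf.1 hf.2⟩
  have : (IsFinitelyPresented (𝒜 := 𝒜)).IsClosedUnderBinaryProducts := ⟨by
    rintro X ⟨p⟩
    refine ObjectProperty.prop_of_iso _ ((BinaryBiproduct.isLimit _ _).conePointsIsoOfNatIso
      p.isLimit (diagramIsoPair _).symm)
      (isFinitelyPresented_biprod (p.prop_diag_obj ⟨.left⟩) (p.prop_diag_obj ⟨.right⟩))⟩
  have := ObjectProperty.IsClosedUnderFiniteProducts.mk' (P := IsFinitelyPresented (𝒜 := 𝒜))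
  exact ⟨inferInstance, rfl⟩

end Freyd

/-! ### Modules over a stable category as cokernels of deflations -/

section Stable

section Cokernel

variable {𝒜 : Type u} [Category.{v} 𝒜] [Preadditive 𝒜]

variable (𝒜) in
/-- The functor that sends a morphism `f : X ⟶ Y` of `𝒜` to the finitely presented module
`Coker(𝒜(-, X) ⟶ 𝒜(-, Y))`. -/
def fpCoker : Arrow 𝒜 ⥤ FPMod 𝒜 :=
  (IsFinitelyPresented (𝒜 := 𝒜)).lift ((preadditiveYoneda (C := 𝒜)).mapArrow ⋙ coker _)
    fun f => (isPresentation_cokernel f.hom).isFinitelyPresented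

/-- The projection of `𝒜(-, Y)` to the cokernel of `𝒜(-, X) ⟶ 𝒜(-, Y)`. -/
abbrev fpCokerπ (f : Arrow 𝒜) : preadditiveYoneda.obj f.right ⟶ ((fpCoker 𝒜).obj f).obj :=
  cokernel.π (preadditiveYoneda.map f.hom)

instance (f : Arrow 𝒜) : Epi (fpCokerπ f) :=
  inferInstanceAs (Epi (cokernel.π (preadditiveYoneda.map f.hom)))

lemma isPresentation_fpCokerπ (f : Arrow 𝒜) : IsPresentation f.hom (fpCokerπ f) :=
  isPresentation_cokernel f.hom

lemma fpCokerπ_map {f g : Arrow 𝒜} (φ : f ⟶ g) :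
    fpCokerπ f ≫ ((fpCoker 𝒜).map φ).hom = preadditiveYoneda.map φ.right ≫ fpCokerπ g :=
  cokernel.π_desc _ _ _

lemma fpCoker_map_eq_iff {f g : Arrow 𝒜} (φ ψ : f ⟶ g) :
    (fpCoker 𝒜).map φ = (fpCoker 𝒜).map ψ ↔
      ∃ s : f.right ⟶ g.left, s ≫ g.hom = φ.right - ψ.right := by
  rw [← (isPresentation_fpCokerπ g).ker, yoneda_app_sub, sub_eq_zero]
  have h : ∀ χ : f ⟶ g, (fpCokerπ f ≫ ((fpCoker 𝒜).map χ).hom).app (op f.right) (𝟙 f.right) =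
      (fpCokerπ g).app (op f.right) χ.right := fun χ => by
    rw [fpCokerπ_map]
    exact congrArg ((fpCokerπ g).app (op f.right)) (Category.id_comp χ.right)
  rw [← h, ← h]
  refine ⟨fun e => by rw [e], fun e => ?_⟩
  apply ObjectProperty.hom_ext
  rw [← cancel_epi (fpCokerπ f)]
  exact yoneda_hom_ext e

/-- A morphism of cokernels is induced by a commutative square, as representable modules are
projective. -/
lemma exists_fpCoker_map {f g : Arrow 𝒜} (α : (fpCoker 𝒜).obj f ⟶ (fpCoker 𝒜).obj g) :
    ∃ φ : f ⟶ g, (fpCoker 𝒜).map φ = α := by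
  obtain ⟨b, hb⟩ := (isPresentation_fpCokerπ g).exists_lift (fpCokerπ f ≫ α.hom)
  obtain ⟨a, ha⟩ := ((isPresentation_fpCokerπ g).ker f.left (f.hom ≫ b)).1 (by
    refine (ConcreteCategory.congr_hom (NatTrans.congr_app hb (op f.left)) f.hom).trans ?_
    refine (congrArg (α.hom.app (op f.left))
      (((isPresentation_fpCokerπ f).ker _ _).2 ⟨𝟙 _, Category.id_comp _⟩)).trans ?_
    exact map_zero (α.hom.app (op f.left)).hom)
  refine ⟨Arrow.homMk a b ha, ?_⟩
  apply ObjectProperty.hom_ext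
  rw [← cancel_epi (fpCokerπ f), fpCokerπ_map]
  exact hb

/-- Up to the identification `e` of the targets, `f` and `g` factor through each other and thus have
the same cokernel. -/
lemma nonempty_iso_fpCoker {X Y : 𝒜} {f : X ⟶ Y} {F : FPMod 𝒜}
    {p : preadditiveYoneda.obj Y ⟶ F.obj} (hp : IsPresentation f p) (g : Arrow 𝒜)
    (e : g.right ≅ Y) (i : X ⟶ g.left) (j : g.left ⟶ X) (hi : i ≫ g.hom ≫ e.hom = f)
    (hj : j ≫ f = g.hom ≫ e.hom) : Nonempty ((fpCoker 𝒜).obj g ≅ F) := by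
  have hq : IsPresentation g.hom (preadditiveYoneda.map e.hom ≫ p) := by
    refine ⟨fun T x => ?_, fun T t => (hp.ker T (t ≫ e.hom)).trans ⟨?_, ?_⟩⟩
    · obtain ⟨t, rfl⟩ := hp.surj T x
      refine ⟨t ≫ e.inv, congrArg (p.app (op T)) ?_⟩
      exact (Category.assoc _ _ _).trans (by rw [e.inv_hom_id, Category.comp_id])
    · rintro ⟨s, hs⟩
      exact ⟨s ≫ i, by rw [← cancel_mono e.hom, ← hs, Category.assoc, Category.assoc, hi]⟩
    · rintro ⟨s, rfl⟩
      exact ⟨s ≫ j, by simp [hj]⟩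
  exact ⟨ObjectProperty.isoMk _ (@asIso _ _ _ _ _ hq.isIso_desc)⟩

end Cokernel

variable {𝒞 : Type u} [Category.{v} 𝒞] [Preadditive 𝒞]
  {𝒬 : Type u} [Category.{v} 𝒬] [Preadditive 𝒬]
  {𝒟 : Type*} [Category* 𝒟]

/-- The properties of deflations, or of inflations as morphisms of the opposite category, on which
the equivalence between deflations and modules rests. Here `π` is the projection to a stable
category, and `J` is the functor that sends an object of `𝒟` to its deflation. -/
structure IsDefectSetting (π : 𝒞 ⥤ 𝒬) (J : 𝒟 ⥤ Arrow 𝒞) : Prop where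
  /-- A commutative square between deflations can be changed, away from the targets, so that it
  comes from a morphism of `𝒟`. -/
  lift : ∀ {D E : 𝒟} (φ : J.obj D ⟶ J.obj E), ∃ f : D ⟶ E, (J.map f).right = φ.right
  /-- Morphisms that vanish stably factor through all deflations. -/
  factors : ∀ (E : 𝒟) {T : 𝒞} (u : T ⟶ (J.obj E).right), π.map u = 0 →
    ∃ s : T ⟶ (J.obj E).left, π.map s = 0 ∧ s ≫ (J.obj E).hom = u
  /-- Every morphism can be extended to a deflation, without changing its image in the stable
  category. -/
  exists_extension : ∀ {X Y : 𝒞} (f : X ⟶ Y), ∃ (E : 𝒟) (e : (J.obj E).right ≅ Y)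
    (i : X ⟶ (J.obj E).left) (j : (J.obj E).left ⟶ X), i ≫ j = 𝟙 X ∧
      i ≫ (J.obj E).hom ≫ e.hom = f ∧ π.map (j ≫ f) = π.map ((J.obj E).hom ≫ e.hom)
  /-- Deflations have weak kernels. -/
  weak_kernel : ∀ E : 𝒟, ∃ (K : 𝒞) (k : K ⟶ (J.obj E).left), k ≫ (J.obj E).hom = 0 ∧
    ∀ {T : 𝒞} (t : T ⟶ (J.obj E).left), t ≫ (J.obj E).hom = 0 → ∃ s : T ⟶ K, s ≫ k = t

/-- The functor that sends an object of `𝒟` to the cokernel of its deflation, as a module over the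
stable category. -/
abbrev stableDefect (π : 𝒞 ⥤ 𝒬) (J : 𝒟 ⥤ Arrow 𝒞) : 𝒟 ⥤ FPMod 𝒬 :=
  J ⋙ π.mapArrow ⋙ fpCoker 𝒬

namespace IsDefectSetting

variable {π : 𝒞 ⥤ 𝒬} [π.Additive] [π.Full] {J : 𝒟 ⥤ Arrow 𝒞} (h : IsDefectSetting π J)

include h

/-- A stable factorization through a deflation lifts to a factorization in `𝒞`. -/
lemma stable_factors (E : 𝒟) {T : 𝒞} (u : T ⟶ (J.obj E).right)
    (s : π.obj T ⟶ π.obj (J.obj E).left) (hs : s ≫ π.map (J.obj E).hom = π.map u) :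
    ∃ t : T ⟶ (J.obj E).left, π.map t = s ∧ t ≫ (J.obj E).hom = u := by
  obtain ⟨s, rfl⟩ := π.map_surjective s
  obtain ⟨r, hr, hr'⟩ := h.factors E (u - s ≫ (J.obj E).hom) (by simp [hs])
  exact ⟨s + r, by simp [hr], by simp [hr']⟩

lemma weakKernelsExist (hπ : ∀ Y : 𝒬, ∃ X : 𝒞, π.obj X = Y) : WeakKernelsExist 𝒬 := by
  intro X Y f
  obtain ⟨X, rfl⟩ := hπ X
  obtain ⟨Y, rfl⟩ := hπ Y
  obtain ⟨f, rfl⟩ := π.map_surjective f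
  obtain ⟨E, e, i, j, hij, hi, hj⟩ := h.exists_extension f
  obtain ⟨K, k, hk, hk'⟩ := h.weak_kernel E
  refine ⟨π.obj K, π.map (k ≫ j), ?_, fun T t ht => ?_⟩
  · rw [← π.map_comp, Category.assoc, π.map_comp, hj, ← π.map_comp, reassoc_of% hk, zero_comp,
      π.map_zero]
  · obtain ⟨T, rfl⟩ := hπ T
    obtain ⟨t, rfl⟩ := π.map_surjective t
    obtain ⟨s, hs, hs'⟩ := h.factors E ((t ≫ i) ≫ (J.obj E).hom) (by
      rw [← π.map_comp, ← hi, ← Category.assoc, ← Category.assoc, π.map_comp] at ht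
      rwa [← cancel_mono (π.map e.hom), zero_comp])
    obtain ⟨m, hm⟩ := hk' (t ≫ i - s) (by simp [hs'])
    refine ⟨π.map m, ?_⟩
    rw [← π.map_comp, ← Category.assoc, hm, π.map_comp, π.map_sub, hs, sub_zero, ← π.map_comp,
      Category.assoc, hij, Category.comp_id]

lemma stableDefect_map_eq_iff {D E : 𝒟} (f g : D ⟶ E) :
    (stableDefect π J).map f = (stableDefect π J).map g ↔
      ∃ s : (J.obj D).right ⟶ (J.obj E).left,
        s ≫ (J.obj E).hom = (J.map f).right - (J.map g).right := by
  refine (fpCoker_map_eq_iff _ _).trans ⟨fun ⟨s, hs⟩ => ?_, fun ⟨s, hs⟩ => ⟨π.map s, ?_⟩⟩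
  · obtain ⟨t, -, ht⟩ := h.stable_factors E ((J.map f).right - (J.map g).right) s
      (hs.trans (π.map_sub).symm)
    exact ⟨t, ht⟩
  · exact ((π.map_comp _ _).symm.trans (congrArg π.map hs)).trans π.map_sub

lemma full_stableDefect : (stableDefect π J).Full where
  map_surjective {D E} α := by
    obtain ⟨φ, hφ⟩ := exists_fpCoker_map α
    obtain ⟨b, hb⟩ := π.map_surjective φ.right
    obtain ⟨a, -, ha⟩ := h.stable_factors E ((J.obj D).hom ≫ b) φ.left (by
      rw [π.map_comp, hb]
      exact φ.w)
    obtain ⟨f, hf⟩ := h.lift (Arrow.homMk a b ha)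
    refine ⟨f, hφ ▸ (fpCoker_map_eq_iff _ _).2 ⟨0, ?_⟩⟩
    rw [zero_comp, eq_comm, sub_eq_zero]
    exact (congrArg π.map hf).trans hb

omit [π.Additive] in
lemma essSurj_stableDefect (hπ : ∀ Y : 𝒬, ∃ X : 𝒞, π.obj X = Y) :
    (stableDefect π J).EssSurj where
  mem_essImage F := by
    obtain ⟨X, Y, f, p, hp⟩ := (isFinitelyPresented_iff F.obj).1 F.property
    obtain ⟨X, rfl⟩ := hπ X
    obtain ⟨Y, rfl⟩ := hπ Y
    obtain ⟨f, rfl⟩ := π.map_surjective f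
    obtain ⟨E, e, i, j, -, hi, hj⟩ := h.exists_extension f
    exact ⟨E, nonempty_iso_fpCoker hp (π.mapArrow.obj (J.obj E)) (π.mapIso e) (π.map i) (π.map j)
      (by rw [← hi, π.map_comp, π.map_comp]; rfl)
      ((π.map_comp _ _).symm.trans (hj.trans (π.map_comp _ _)))⟩

/-- Pulled back along `π`, the stable cokernel of a deflation is its cokernel: the morphisms
that vanish stably factor through the deflation anyway. -/
lemma nonempty_restrict_iso :
    Nonempty (stableDefect π J ⋙ (IsFinitelyPresented (𝒜 := 𝒬)).ι ⋙
      (Functor.whiskeringLeft _ _ _).obj π.op ≅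
        J ⋙ (preadditiveYoneda (C := 𝒞)).mapArrow ⋙ coker _) := by
  let ψ : ∀ g : Arrow 𝒞, preadditiveYoneda.obj g.right ⟶
      π.op ⋙ ((fpCoker 𝒬).obj (π.mapArrow.obj g)).obj := fun g =>
    preadditiveYonedaMap π g.right ≫ Functor.whiskerLeft π.op (fpCokerπ (π.mapArrow.obj g))
  have hψ : ∀ (g : Arrow 𝒞) (T : 𝒞) (t : T ⟶ g.right), (ψ g).app (op T) t =
      (fpCokerπ (π.mapArrow.obj g)).app (op (π.obj T)) (π.map t) := fun g T t => rfl
  have hψ₀ : ∀ g : Arrow 𝒞, preadditiveYoneda.map g.hom ≫ ψ g = 0 := fun g => by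
    refine yoneda_hom_ext ?_
    refine (hψ g _ (𝟙 _ ≫ g.hom)).trans
      (((isPresentation_fpCokerπ (π.mapArrow.obj g)).ker _ _).2 ⟨𝟙 _, ?_⟩)
    exact (Category.id_comp _).trans (congrArg π.map (Category.id_comp _).symm)
  let τ : ∀ g : Arrow 𝒞, cokernel (preadditiveYoneda.map g.hom) ⟶
      π.op ⋙ ((fpCoker 𝒬).obj (π.mapArrow.obj g)).obj := fun g => cokernel.desc _ (ψ g) (hψ₀ g)
  have hτ : ∀ (g : Arrow 𝒞) (T : 𝒞) (t : T ⟶ g.right),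
      (τ g).app (op T) ((cokernel.π (preadditiveYoneda.map g.hom)).app (op T) t) =
      (ψ g).app (op T) t := fun g T t =>
    ConcreteCategory.congr_hom (NatTrans.congr_app (cokernel.π_desc _ (ψ g) (hψ₀ g)) (op T)) t
  have hτ' : ∀ E : 𝒟, IsIso (τ (J.obj E)) := fun E => by
    refine isIso_of_bijective _ (fun T x hx => ?_) (fun T x => ?_)
    · obtain ⟨t, rfl⟩ := (isPresentation_cokernel _).surj T x
      rw [hτ, hψ] at hx
      obtain ⟨s, hs⟩ := ((isPresentation_fpCokerπ (π.mapArrow.obj (J.obj E))).ker _ _).1 hx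
      obtain ⟨r, -, hr⟩ := h.stable_factors E t s hs
      exact ((isPresentation_cokernel _).ker T t).2 ⟨r, hr⟩
    · obtain ⟨t, rfl⟩ := (isPresentation_fpCokerπ (π.mapArrow.obj (J.obj E))).surj (π.obj T) x
      obtain ⟨t, rfl⟩ := π.map_surjective t
      exact ⟨_, (hτ _ T t).trans (hψ _ T t)⟩
  refine ⟨(NatIso.ofComponents (fun E => @asIso _ _ _ _ (τ (J.obj E)) (hτ' E))
    fun {D E} f => ?_).symm⟩
  refine coequalizer.hom_ext (yoneda_hom_ext ?_)
  have h₁ : cokernel.π (preadditiveYoneda.map (J.obj D).hom) ≫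
      (coker _).map ((preadditiveYoneda (C := 𝒞)).mapArrow.map (J.map f)) =
      preadditiveYoneda.map (J.map f).right ≫ cokernel.π (preadditiveYoneda.map (J.obj E).hom) :=
    cokernel.π_desc _ _ _
  have h₂ := fpCokerπ_map (π.mapArrow.map (J.map f))
  have h₃ : (τ (J.obj E)).app _ ((cokernel.π (preadditiveYoneda.map (J.obj D).hom) ≫
      (coker _).map ((preadditiveYoneda (C := 𝒞)).mapArrow.map (J.map f))).app
        (op (J.obj D).right) (𝟙 _)) =
      (fpCokerπ (π.mapArrow.obj (J.obj E))).app _ (π.map (J.map f).right) := by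
    rw [h₁]
    refine (hτ _ _ (𝟙 _ ≫ (J.map f).right)).trans ?_
    rw [hψ, Category.id_comp]
  refine h₃.trans (Eq.symm ?_)
  refine (congrArg (((fpCoker 𝒬).map (π.mapArrow.map (J.map f))).hom.app _)
    ((hτ _ _ (𝟙 _)).trans (hψ _ _ (𝟙 _)))).trans ?_
  refine (ConcreteCategory.congr_hom (NatTrans.congr_app h₂ _) (π.map (𝟙 _))).trans ?_
  refine congrArg ((fpCokerπ (π.mapArrow.obj (J.obj E))).app _) ?_
  change π.map (𝟙 _) ≫ π.map (J.map f).right = _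
  rw [π.map_id, Category.id_comp]

end IsDefectSetting

end Stable

/-! ### Ideal quotients, and functors that identify the same morphisms -/

/-- Two full and essentially surjective functors that identify the same morphisms differ by an
equivalence. -/
lemma exists_equivalence_of_homRel {𝒟 𝒳 𝒴 : Type*} [Category* 𝒟] [Category* 𝒳] [Category* 𝒴]
    (L : 𝒟 ⥤ 𝒳) (R : 𝒟 ⥤ 𝒴) [L.Full] [L.EssSurj] [R.Full] [R.EssSurj]
    (h : ∀ {D E : 𝒟} (f g : D ⟶ E), L.map f = L.map g ↔ R.map f = R.map g) :
    ∃ Φ : 𝒳 ⥤ 𝒴, Φ.IsEquivalence ∧ Nonempty (L ⋙ Φ ≅ R) := by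
  obtain ⟨r, hL, hR⟩ : ∃ r : HomRel 𝒟, r = L.homRel ∧ r = R.homRel :=
    ⟨L.homRel, rfl, by funext D E f g; exact propext (h f g)⟩
  have hL' : ∀ (D E : 𝒟) (f g : D ⟶ E), r f g → L.map f = L.map g := by
    subst hL; exact fun _ _ _ _ h => h
  have hR' : ∀ (D E : 𝒟) (f g : D ⟶ E), r f g → R.map f = R.map g := by
    subst hR; exact fun _ _ _ _ h => h
  have : (CategoryTheory.Quotient.lift r L hL').IsEquivalence := by
    subst hL; infer_instance
  have : (CategoryTheory.Quotient.lift r R hR').IsEquivalence := by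
    clear hL; subst hR; infer_instance
  let e := (CategoryTheory.Quotient.lift r L hL').asEquivalence
  refine ⟨e.inverse ⋙ CategoryTheory.Quotient.lift r R hR', inferInstance, ⟨?_⟩⟩
  exact Functor.isoWhiskerRight (CategoryTheory.Quotient.lift.isLift r L hL').symm _ ≪≫
    Functor.associator _ _ _ ≪≫
    Functor.isoWhiskerLeft (CategoryTheory.Quotient.functor r)
      ((Functor.associator _ _ _).symm ≪≫
        Functor.isoWhiskerRight e.unitIso.symm _ ≪≫ Functor.leftUnitor _) ≪≫
    CategoryTheory.Quotient.lift.isLift r R hR'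

/-- An equivalence preserves binary products and hence is additive as soon as these exist. -/
lemma IsAbelianCategory.of_equivalence {𝒜 : Type*} {ℬ : Type*} [Category* 𝒜] [Category* ℬ]
    [Preadditive 𝒜] [Preadditive ℬ] (F : 𝒜 ⥤ ℬ) [F.IsEquivalence] (h : IsAbelianCategory ℬ) :
    IsAbelianCategory 𝒜 ∧ F.Additive := by
  obtain ⟨inst, rfl⟩ := h
  have : HasFiniteProducts 𝒜 := ⟨fun _ => Adjunction.hasLimitsOfShape_of_equivalence F⟩
  exact ⟨⟨abelianOfEquivalence F, rfl⟩, F.additive_of_preserves_binary_products⟩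

lemma IsAbelianCategory.op {𝒜 : Type*} [Category* 𝒜] [Preadditive 𝒜]
    (h : IsAbelianCategory 𝒜) : IsAbelianCategory 𝒜ᵒᵖ := by
  obtain ⟨inst, rfl⟩ := h
  exact ⟨inferInstance, rfl⟩

section Quotients

variable {𝒜 : Type u} [Category.{v} 𝒜] [Preadditive 𝒜]

instance toQuotient_additive (P : ObjectProperty 𝒜) : (toQuotient P).Additive :=
  CategoryTheory.Quotient.functor_additive (idealRel P) _

lemma toQuotient_map_eq_iff (P : ObjectProperty 𝒜) {X Y : 𝒜} (f g : X ⟶ Y) :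
    (toQuotient P).map f = (toQuotient P).map g ↔ f - g ∈ ideal P X Y :=
  CategoryTheory.Quotient.functor_map_eq_iff (idealRel P) f g

lemma toQuotient_map_eq_zero_iff (P : ObjectProperty 𝒜) {X Y : 𝒜} (f : X ⟶ Y) :
    (toQuotient P).map f = 0 ↔ f ∈ ideal P X Y := by
  rw [← (toQuotient P).map_zero, toQuotient_map_eq_iff, sub_zero]

variable [HasZeroObject 𝒜] [HasBinaryBiproducts 𝒜] (P : ObjectProperty 𝒜)

instance : HasZeroObject (IdealQuotient P) := (toQuotient P).hasZeroObject_of_additive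

instance : HasBinaryBiproducts (IdealQuotient P) :=
  ⟨fun X Y => by
    have := preservesBinaryBiproducts_of_preservesBiproducts (toQuotient P)
    exact Functor.hasBinaryBiproduct_of_preserves (toQuotient P) (X := X.as) (Y := Y.as)⟩

end Quotients

/-! ### Exact sequences and deflations in an `n`-exangulated category -/

section Extensions

variable {𝒞 : Type u} [Category.{v} 𝒞] {𝔼 : 𝒞ᵒᵖ ⥤ 𝒞 ⥤ AddCommGrpCat.{w}}

lemma push_id {A C : 𝒞} (δ : Ext 𝔼 C A) : push (𝟙 A) δ = δ := by simp [push]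

lemma pull_id {A C : 𝒞} (δ : Ext 𝔼 C A) : pull (𝟙 C) δ = δ := by simp [pull]

lemma push_comp {A A' A'' C : 𝒞} (a : A ⟶ A') (a' : A' ⟶ A'') (δ : Ext 𝔼 C A) :
    push (a ≫ a') δ = push a' (push a δ) := by simp [push]

lemma pull_comp {A C C' C'' : 𝒞} (c : C'' ⟶ C') (c' : C' ⟶ C) (δ : Ext 𝔼 C A) :
    pull (c ≫ c') δ = pull c (pull c' δ) := by simp [pull]

lemma push_add {A A' C : 𝒞} (a : A ⟶ A') (δ ρ : Ext 𝔼 C A) :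
    push a (δ + ρ) = push a δ + push a ρ :=
  map_add ((𝔼.obj (op C)).map a).hom δ ρ

lemma pull_add {A C C' : 𝒞} (c : C' ⟶ C) (δ ρ : Ext 𝔼 C A) :
    pull c (δ + ρ) = pull c δ + pull c ρ :=
  map_add ((𝔼.map c.op).app A).hom δ ρ

lemma push_zero {A A' C : 𝒞} (a : A ⟶ A') : push a (0 : Ext 𝔼 C A) = 0 :=
  map_zero ((𝔼.obj (op C)).map a).hom

lemma pull_zero {A C C' : 𝒞} (c : C' ⟶ C) : pull c (0 : Ext 𝔼 C A) = 0 :=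
  map_zero ((𝔼.map c.op).app A).hom

variable [Preadditive 𝒞]

section

variable [∀ C : 𝒞ᵒᵖ, (𝔼.obj C).Additive]

lemma add_push {A A' C : 𝒞} (a a' : A ⟶ A') (δ : Ext 𝔼 C A) :
    push (a + a') δ = push a δ + push a' δ := by
  simp only [push, Functor.map_add]
  rfl

lemma sub_push {A A' C : 𝒞} (a a' : A ⟶ A') (δ : Ext 𝔼 C A) :
    push (a - a') δ = push a δ - push a' δ := by
  rw [eq_sub_iff_add_eq, ← add_push, sub_add_cancel]

lemma zero_push {A A' C : 𝒞} (δ : Ext 𝔼 C A) : push (0 : A ⟶ A') δ = 0 := by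
  rw [← sub_self (0 : A ⟶ A'), sub_push, sub_self]

end

variable [𝔼.Additive]

lemma add_pull {A C C' : 𝒞} (c c' : C' ⟶ C) (δ : Ext 𝔼 C A) :
    pull (c + c') δ = pull c δ + pull c' δ := by
  simp only [pull, op_add, Functor.map_add]
  rfl

lemma sub_pull {A C C' : 𝒞} (c c' : C' ⟶ C) (δ : Ext 𝔼 C A) :
    pull (c - c') δ = pull c δ - pull c' δ := by
  rw [eq_sub_iff_add_eq, ← add_pull, sub_add_cancel]

lemma zero_pull {A C C' : 𝒞} (δ : Ext 𝔼 C A) : pull (0 : C' ⟶ C) δ = 0 := by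
  rw [← sub_self (0 : C' ⟶ C), sub_pull, sub_self]

end Extensions

section Exangles

variable {𝒞 : Type u} [Category.{v} 𝒞] [Preadditive 𝒞]
  {𝔼 : 𝒞ᵒᵖ ⥤ 𝒞 ⥤ AddCommGrpCat.{w}} {n : ℕ}

lemma CpxBetween.HasEnds.dFirst_comp {A C A' C' : 𝒞} {X : CpxBetween n A C}
    {Y : CpxBetween n A' C'} {f : X.K ⟶ Y.K} {a : A ⟶ A'} {c : C ⟶ C'} (h : X.HasEnds Y f a c) :
    X.dFirst ≫ f.f 1 = a ≫ Y.dFirst := by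
  have h₁ : X.left.inv ≫ f.f 0 = a ≫ Y.left.inv := by
    rw [Iso.inv_comp_eq, ← Category.assoc, Iso.eq_comp_inv, h.1]
  simp [dFirst, ← reassoc_of% h₁]

lemma CpxBetween.HasEnds.comp_dLast {A C A' C' : 𝒞} {X : CpxBetween n A C}
    {Y : CpxBetween n A' C'} {f : X.K ⟶ Y.K} {a : A ⟶ A'} {c : C ⟶ C'} (h : X.HasEnds Y f a c) :
    f.f n ≫ Y.dLast = X.dLast ≫ c := by
  simp [dLast, ← h.2]

lemma CpxBetween.HasEnds.comp {A C A' C' A'' C'' : 𝒞} {X : CpxBetween n A C}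
    {Y : CpxBetween n A' C'} {Z : CpxBetween n A'' C''} {f : X.K ⟶ Y.K} {g : Y.K ⟶ Z.K}
    {a : A ⟶ A'} {c : C ⟶ C'} {a' : A' ⟶ A''} {c' : C' ⟶ C''} (h : X.HasEnds Y f a c)
    (h' : Y.HasEnds Z g a' c') : X.HasEnds Z (f ≫ g) (a ≫ a') (c ≫ c') :=
  ⟨by rw [HomologicalComplex.comp_f, Category.assoc, h'.1, reassoc_of% h.1],
    by rw [HomologicalComplex.comp_f, Category.assoc, h'.2, reassoc_of% h.2]⟩

lemma IsExangle.push_dFirst {A C : 𝒞} {X : CpxBetween n A C} {δ : Ext 𝔼 C A}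
    (h : IsExangle X δ) : push X.dFirst δ = 0 :=
  (h.exact_co_first _ _).2 ⟨𝟙 _, Category.comp_id _⟩

lemma IsExangle.pull_dLast {A C : 𝒞} {X : CpxBetween n A C} {δ : Ext 𝔼 C A}
    (h : IsExangle X δ) : pull X.dLast δ = 0 :=
  (h.exact_contra_last _ _).2 ⟨𝟙 _, Category.id_comp _⟩

lemma IsExangle.exists_comp_of_comp_dLast {m : ℕ} {A C T : 𝒞} {X : CpxBetween (m + 1) A C}
    {δ : Ext 𝔼 C A} (h : IsExangle X δ) (t : T ⟶ X.K.X (m + 1)) (ht : t ≫ X.dLast = 0) :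
    ∃ s : T ⟶ X.K.X m, s ≫ X.K.d m (m + 1) = t :=
  h.exact_contra m (Nat.lt_succ_self m) T t (by
    rwa [← cancel_mono X.right.hom, zero_comp, Category.assoc])

lemma IsExangle.exists_comp_of_dFirst_comp {m : ℕ} {A C T : 𝒞} {X : CpxBetween (m + 1) A C}
    {δ : Ext 𝔼 C A} (h : IsExangle X δ) (t : X.K.X 1 ⟶ T) (ht : X.dFirst ≫ t = 0) :
    ∃ s : X.K.X 2 ⟶ T, X.K.d 1 2 ≫ s = t :=
  h.exact_co 0 (Nat.succ_pos m) T t (by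
    rwa [← cancel_epi X.left.inv, comp_zero, ← Category.assoc])

lemma exists_realizes (𝔰 : Correspondence 𝔼 n) {A C : 𝒞} (δ : Ext 𝔼 C A) :
    ∃ X : CpxBetween n A C, Realizes 𝔰 X δ := by
  obtain ⟨X, hX⟩ := _root_.Quotient.exists_rep (𝔰 δ)
  exact ⟨X, hX.symm⟩

variable [HasZeroObject 𝒞] [HasBinaryBiproducts 𝒞]

lemma mappingCone_dLast {m : ℕ} {A C D : 𝒞} {X : CpxBetween (m + 1) A C}
    {Y : CpxBetween (m + 1) A D} {f : X.K ⟶ Y.K} {a : A ⟶ A} {c : C ⟶ D}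
    (h : X.HasEnds Y f a c) : (mappingCone X Y f).dLast =
      (biprod.desc (X.right.hom ≫ c) Y.dLast : X.K.X (m + 2) ⊞ Y.K.X (m + 1) ⟶ D) := by
  have h₁ : (mappingCone X Y f).dLast = (coneCpx f).d (m + 1) (m + 2) ≫
    (biprod.snd : X.K.X (m + 3) ⊞ Y.K.X (m + 2) ⟶ Y.K.X (m + 2)) ≫ Y.right.hom := rfl
  rw [h₁, coneCpx_d_succ, biprod.lift_snd_assoc, Preadditive.add_comp]
  apply biprod.hom_ext'
  · simp [h.2]
  · simp [CpxBetween.dLast]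

lemma mappingCocone_dFirst {A B C : 𝒞} {X : CpxBetween n A C}
    {Y : CpxBetween n B C} {f : X.K ⟶ Y.K} {a : A ⟶ B} {c : C ⟶ C}
    (h : X.HasEnds Y f a c) : (mappingCocone X Y f).dFirst =
      (biprod.lift (X.dFirst ≫ keepπ _ _) (a ≫ Y.left.inv ≫ keepπ _ _) :
        A ⟶ keep (1 ≤ n) (X.K.X 1) ⊞ keep (0 ≤ n) (Y.K.X 0)) := by
  have h₁ : (mappingCocone X Y f).dFirst = X.left.inv ≫ (coconeCpx n f).d 0 1 := rfl
  have h₂ : X.left.inv ≫ f.f 0 = a ≫ Y.left.inv := by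
    rw [Iso.inv_comp_eq, ← Category.assoc, Iso.eq_comp_inv, h.1]
  rw [h₁, coconeCpx_d_zero]
  apply biprod.hom_ext
  · simp [CpxBetween.dFirst]
  · simp [reassoc_of% h₂]

variable {𝔰 : Correspondence 𝔼 n} (h𝔰 : IsNExangulated 𝔰)

include h𝔰

section

variable [∀ C : 𝒞ᵒᵖ, (𝔼.obj C).Additive]

/-- Exactness of `𝒞(A, A') ⟶ 𝔼(C, A') ⟶ 𝔼(Xⁿ, A')`. -/
lemma exists_push_eq {A A' C : 𝒞} {δ : Ext 𝔼 C A} {X : CpxBetween n A C}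
    (hX : Realizes 𝔰 X δ) (θ : Ext 𝔼 C A') (hθ : pull X.dLast θ = 0) :
    ∃ a : A ⟶ A', push a δ = θ := by
  -- the cocone of a good lift over `A ⊞ A' ⟶ A` realizes the zero extension, so its inflation splits
  let η : Ext 𝔼 C (A ⊞ A') := push biprod.inl δ + push biprod.inr θ
  have h₁ : push biprod.fst η = δ := by
    simp only [η, push_add, ← push_comp, biprod.inl_fst, biprod.inr_fst, push_id, zero_push,
      add_zero]
  have h₂ : push biprod.snd η = θ := by
    simp only [η, push_add, ← push_comp, biprod.inl_snd, biprod.inr_snd, push_id, zero_push,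
      zero_add]
  have h₃ : pull X.dLast η = 0 := by
    simp only [η, pull_add, ← DistExangle.push_pull, hθ, (h𝔰.exangle δ X hX).pull_dLast,
      push_zero, add_zero]
  obtain ⟨U, hU⟩ := exists_realizes 𝔰 η
  obtain ⟨f, hf, hf'⟩ := h𝔰.good_lift_op η biprod.fst U X hU (h₁.symm ▸ hX)
  rw [h₃] at hf'
  obtain ⟨a, v, hav⟩ : ∃ (a : A ⟶ A') (v : U.K.X 1 ⟶ A'),
      U.dFirst ≫ v + biprod.fst ≫ a = (biprod.snd : A ⊞ A' ⟶ A') := by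
    obtain ⟨s, hs⟩ : ∃ s : keep (1 ≤ n) (U.K.X 1) ⊞ keep (0 ≤ n) (X.K.X 0) ⟶ A',
        biprod.lift (U.dFirst ≫ keepπ _ _) (biprod.fst ≫ X.left.inv ≫ keepπ _ _) ≫ s =
          biprod.snd := by
      rw [← mappingCocone_dFirst hf]
      exact ((h𝔰.exangle _ _ hf').exact_co_first _ _).1 (push_zero _)
    exact ⟨X.left.inv ≫ keepπ _ _ ≫ biprod.inr ≫ s, keepπ _ _ ≫ biprod.inl ≫ s, by
      simpa [biprod.lift_eq] using hs⟩
  refine ⟨a, ?_⟩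
  rw [← h₂, ← hav, add_push, push_comp, (h𝔰.exangle _ _ hU).push_dFirst, push_zero, zero_add,
    push_comp biprod.fst, h₁]

end

variable (hn : 0 < n)

include hn

/-- Exactness of `𝒞(C', C) ⟶ 𝔼(C', A) ⟶ 𝔼(C', X¹)`. -/
lemma exists_pull_eq [𝔼.Additive] {A C C' : 𝒞} {δ : Ext 𝔼 C A} {X : CpxBetween n A C}
    (hX : Realizes 𝔰 X δ) (θ : Ext 𝔼 C' A) (hθ : push X.dFirst θ = 0) :
    ∃ c : C' ⟶ C, pull c δ = θ := by
  obtain ⟨m, rfl⟩ : ∃ m, n = m + 1 := ⟨n - 1, by omega⟩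
  -- the cone of a good lift over `C ⟶ C ⊞ C'` realizes the zero extension, so its deflation splits
  let η : Ext 𝔼 (C ⊞ C') A := pull biprod.fst δ + pull biprod.snd θ
  have h₁ : pull biprod.inl η = δ := by
    simp only [η, pull_add, ← pull_comp, biprod.inl_fst, biprod.inl_snd, pull_id, zero_pull,
      add_zero]
  have h₂ : pull biprod.inr η = θ := by
    simp only [η, pull_add, ← pull_comp, biprod.inr_fst, biprod.inr_snd, pull_id, zero_pull,
      zero_add]
  have h₃ : push X.dFirst η = 0 := by
    simp only [η, push_add, DistExangle.push_pull, hθ, (h𝔰.exangle δ X hX).push_dFirst,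
      pull_zero, add_zero]
  obtain ⟨U, hU⟩ := exists_realizes 𝔰 η
  obtain ⟨f, hf, hf'⟩ := h𝔰.good_lift η biprod.inl X U (h₁.symm ▸ hX) hU
  rw [h₃] at hf'
  obtain ⟨c, v, hcv⟩ : ∃ (c : C' ⟶ C) (v : C' ⟶ U.K.X (m + 1)),
      c ≫ biprod.inl + v ≫ U.dLast = (biprod.inr : C' ⟶ C ⊞ C') := by
    obtain ⟨s, hs⟩ : ∃ s : C' ⟶ X.K.X (m + 2) ⊞ U.K.X (m + 1),
        s ≫ biprod.desc (X.right.hom ≫ biprod.inl) U.dLast = biprod.inr := by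
      rw [← mappingCone_dLast hf]
      exact ((h𝔰.exangle _ _ hf').exact_contra_last _ _).1 (pull_zero _)
    exact ⟨s ≫ biprod.fst ≫ X.right.hom, s ≫ biprod.snd, by simpa [biprod.desc_eq] using hs⟩
  refine ⟨c, ?_⟩
  rw [← h₂, ← hcv, add_pull, pull_comp, pull_comp v, h₁, (h𝔰.exangle _ _ hU).pull_dLast,
    pull_zero, add_zero]

/-- Every morphism into the target of a deflation can be joined to it. -/
lemma isDeflation_desc {B C D : 𝒞} (c : C ⟶ D) (g : B ⟶ D) (hg : IsDeflation 𝔰 g) :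
    IsDeflation 𝔰 (biprod.desc c g) := by
  obtain ⟨m, rfl⟩ : ∃ m, n = m + 1 := ⟨n - 1, by omega⟩
  obtain ⟨A, ρ, Y, hY, e, rfl⟩ := hg
  obtain ⟨X, hX⟩ := exists_realizes 𝔰 (pull c ρ)
  obtain ⟨f, hf, hf'⟩ := h𝔰.good_lift ρ c X Y hX hY
  refine ⟨_, _, _, hf', biprod.mapIso X.right.symm e, ?_⟩
  rw [mappingCone_dLast hf]
  change biprod.map X.right.inv e.hom ≫ _ = _
  apply biprod.hom_ext' <;> simp

lemma isDeflation_id (A : 𝒞) : IsDeflation 𝔰 (𝟙 A) := by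
  let K := HomologicalComplex.double (𝟙 A)
    (show (ComplexShape.up ℕ).Rel n (n + 1) from rfl)
  have hne : n ≠ n + 1 := by omega
  have hK : ∀ i, i ≠ n → i ≠ n + 1 → IsZero (K.X i) := fun i h h' =>
    HomologicalComplex.isZero_double_X _ _ i h h'
  let e₀ : K.X n ≅ A := HomologicalComplex.doubleXIso₀ _ _
  let e₁ : K.X (n + 1) ≅ A := HomologicalComplex.doubleXIso₁ _ _ hne
  have hd : K.d n (n + 1) = e₀.hom ≫ 𝟙 A ≫ e₁.inv := HomologicalComplex.double_d _ _ hne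
  obtain ⟨Z, hZ⟩ := HasZeroObject.zero (C := 𝒞)
  let X : CpxBetween n Z A :=
    { K := K
      isZero := fun i hi => hK i (by omega) (by omega)
      left := (hK 0 (by omega) (by omega)).iso hZ
      right := e₁ }
  refine ⟨Z, 0, X, h𝔰.zero_left X hZ ?_ (fun i hi => hK i (by omega) (by omega)), e₀.symm, ?_⟩
  · change IsIso (K.d n (n + 1))
    rw [hd]
    infer_instance
  · change e₀.inv ≫ K.d n (n + 1) ≫ e₁.hom = 𝟙 A
    simp [hd]

end Exangles

/-! ### Realized extensions and the category of deflations -/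

section Realizations

variable {𝒞 : Type u} [Category.{v} 𝒞] [Preadditive 𝒞]
  {𝔼 : 𝒞ᵒᵖ ⥤ 𝒞 ⥤ AddCommGrpCat.{w}} {n : ℕ}

/-- The extensions `δ ∈ 𝔼(C, A)` together with a complex that realizes them. In contrast to
`DistExangle`, the end terms of the complex are only identified with `A` and `C` up to
isomorphism, so that every deflation comes from an object of this kind. -/
structure RealizedExt (𝔰 : Correspondence 𝔼 n) where
  A : 𝒞
  C : 𝒞
  δ : Ext 𝔼 C A
  X : CpxBetween n A C
  realizes : Realizes 𝔰 X δ

namespace RealizedExt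

variable {𝔰 : Correspondence 𝔼 n}

/-- A morphism of realized extensions: a morphism `(a, c)` of extensions and a lift of it to the
complexes. -/
@[ext]
structure Hom (D E : RealizedExt 𝔰) where
  f : D.X.K ⟶ E.X.K
  a : D.A ⟶ E.A
  c : D.C ⟶ E.C
  ends : D.X.HasEnds E.X f a c
  comm : push a D.δ = pull c E.δ

instance : Category (RealizedExt 𝔰) where
  Hom := Hom
  id D := ⟨𝟙 _, 𝟙 _, 𝟙 _, by simp [CpxBetween.HasEnds], by rw [push_id, pull_id]⟩
  comp φ ψ := ⟨φ.f ≫ ψ.f, φ.a ≫ ψ.a, φ.c ≫ ψ.c, φ.ends.comp ψ.ends, by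
    rw [push_comp, φ.comm, DistExangle.push_pull, ψ.comm, pull_comp]⟩
  id_comp φ := Hom.ext (Category.id_comp _) (Category.id_comp _) (Category.id_comp _)
  comp_id φ := Hom.ext (Category.comp_id _) (Category.comp_id _) (Category.comp_id _)
  assoc φ ψ χ := Hom.ext (Category.assoc _ _ _) (Category.assoc _ _ _) (Category.assoc _ _ _)

variable (𝔰)

/-- The functor that sends a realized extension to its deflation `dⁿ : Xⁿ ⟶ C`. -/
def deflation : RealizedExt 𝔰 ⥤ SDef 𝔰 where
  obj D := ⟨Arrow.mk D.X.dLast, D.A, D.δ, D.X, D.realizes, Iso.refl _, Category.id_comp _⟩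
  map φ := ObjectProperty.homMk (Arrow.homMk (φ.f.f n) φ.c φ.ends.comp_dLast)
  map_id _ := rfl
  map_comp _ _ := rfl

/-- The functor that sends a realized extension to its inflation `d⁰ : A ⟶ X¹`, as a morphism of
the opposite category. -/
def inflationOp : (RealizedExt 𝔰)ᵒᵖ ⥤ Arrow 𝒞ᵒᵖ where
  obj D := Arrow.mk D.unop.X.dFirst.op
  map φ := Arrow.homMk (φ.unop.f.f 1).op φ.unop.a.op
    (congrArg Quiver.Hom.op φ.unop.ends.dFirst_comp)
  map_id _ := rfl
  map_comp _ _ := rfl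

/-- A distinguished `n`-exangle, as a realized extension. -/
def ofDistExangle : DistExangle 𝔰 ⥤ RealizedExt 𝔰 where
  obj X := ⟨_, _, X.δ, X.cpx.between, X.realizes⟩
  map φ := ⟨φ.f, φ.f.f 0, φ.f.f (n + 1), by simp [CpxBetween.HasEnds, Cpx.between], φ.comm⟩
  map_id _ := rfl
  map_comp _ _ := rfl

/-- The deflation of a distinguished `n`-exangle is that of the realized extension. -/
def ofDistExangleDeflationIso : ofDistExangle 𝔰 ⋙ deflation 𝔰 ≅ DistExangle.deflation 𝔰 :=
  NatIso.ofComponents (fun X => ObjectProperty.isoMk _ (Arrow.isoMk (Iso.refl _) (Iso.refl _) (by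
    simp [ofDistExangle, deflation, DistExangle.deflation, CpxBetween.dLast, Cpx.between])))
    fun φ => by
      apply ObjectProperty.hom_ext
      apply Arrow.hom_ext
      · exact (Category.comp_id _).trans (Category.id_comp _).symm
      · exact (Category.comp_id _).trans (Category.id_comp _).symm

/-- The inflation of a distinguished `n`-exangle is that of the realized extension. -/
def ofDistExangleInflationOpIso :
    (ofDistExangle 𝔰).op ⋙ inflationOp 𝔰 ≅ DistExangle.inflationOp 𝔰 :=
  NatIso.ofComponents (fun X => Arrow.isoMk (Iso.refl _) (Iso.refl _) (by
    simp [ofDistExangle, inflationOp, DistExangle.inflationOp, CpxBetween.dFirst, Cpx.between]))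
    fun φ => by
      apply Arrow.hom_ext
      · exact (Category.comp_id _).trans (Category.id_comp _).symm
      · exact (Category.comp_id _).trans (Category.id_comp _).symm

end RealizedExt

variable {𝔰 : Correspondence 𝔼 n}

lemma exists_lift_of_mem_ideal_splitEpis {g g' : SDef 𝔰} {φ : g ⟶ g'}
    (hφ : φ ∈ ideal (splitEpis 𝔰) g g') :
    ∃ s : g.obj.right ⟶ g'.obj.left, s ≫ g'.obj.hom = φ.hom.right := by
  induction hφ using AddSubgroup.closure_induction with
  | mem φ hφ =>
    obtain ⟨k, hk, a, b, rfl⟩ := hφ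
    have : IsSplitEpi k.obj.hom := hk
    refine ⟨a.hom.right ≫ section_ k.obj.hom ≫ b.hom.left, ?_⟩
    simp
  | zero => exact ⟨0, zero_comp⟩
  | add φ ψ _ _ h₁ h₂ =>
    obtain ⟨s, hs⟩ := h₁
    obtain ⟨t, ht⟩ := h₂
    exact ⟨s + t, by rw [Preadditive.add_comp, hs, ht]; rfl⟩
  | neg φ _ h =>
    obtain ⟨s, hs⟩ := h
    exact ⟨-s, by rw [Preadditive.neg_comp, hs]; rfl⟩

lemma essSurj_deflation : (RealizedExt.deflation 𝔰).EssSurj where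
  mem_essImage g := by
    obtain ⟨A, δ, X, hX, e, he⟩ := g.property
    exact ⟨⟨A, g.obj.right, δ, X, hX⟩, ⟨ObjectProperty.isoMk _
      (Arrow.isoMk e.symm (Iso.refl _) (by
        change e.inv ≫ g.obj.hom = X.dLast ≫ 𝟙 _
        rw [← he, e.inv_hom_id_assoc, Category.comp_id]))⟩⟩

lemma exists_comp_eq_of_mem_ideal_isProjective {B C T : 𝒞} {g : B ⟶ C} (hg : IsDeflation 𝔰 g)
    {u : T ⟶ C} (hu : u ∈ ideal (IsProjective 𝔰) T C) :
    ∃ s ∈ ideal (IsProjective 𝔰) T B, s ≫ g = u := by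
  obtain ⟨A, δ, X, hX, e, rfl⟩ := hg
  induction hu using AddSubgroup.closure_induction with
  | mem u hu =>
    obtain ⟨Q, hQ, a, b, rfl⟩ := hu
    obtain ⟨b, rfl⟩ := hQ _ _ δ X hX b
    exact ⟨a ≫ b ≫ e.inv, AddSubgroup.subset_closure ⟨Q, hQ, _, _, rfl⟩, by simp⟩
  | zero => exact ⟨0, zero_mem _, zero_comp⟩
  | add u u' _ _ h h' =>
    obtain ⟨s, hs, rfl⟩ := h
    obtain ⟨t, ht, rfl⟩ := h'
    exact ⟨s + t, add_mem hs ht, Preadditive.add_comp _ _ _ _ _ _⟩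
  | neg u _ h =>
    obtain ⟨s, hs, rfl⟩ := h
    exact ⟨-s, neg_mem hs, Preadditive.neg_comp _ _⟩

lemma exists_comp_eq_of_mem_ideal_isInjective (D : RealizedExt 𝔰) {T : 𝒞} {u : D.A ⟶ T}
    (hu : u ∈ ideal (IsInjective 𝔰) D.A T) :
    ∃ s ∈ ideal (IsInjective 𝔰) (D.X.K.X 1) T, D.X.dFirst ≫ s = u := by
  induction hu using AddSubgroup.closure_induction with
  | mem u hu =>
    obtain ⟨Q, hQ, a, b, rfl⟩ := hu
    obtain ⟨a, rfl⟩ := hQ _ _ D.δ D.X D.realizes a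
    exact ⟨a ≫ b, AddSubgroup.subset_closure ⟨Q, hQ, _, _, rfl⟩, by simp⟩
  | zero => exact ⟨0, zero_mem _, comp_zero⟩
  | add u u' _ _ h h' =>
    obtain ⟨s, hs, rfl⟩ := h
    obtain ⟨t, ht, rfl⟩ := h'
    exact ⟨s + t, add_mem hs ht, Preadditive.comp_add _ _ _ _ _ _⟩
  | neg u _ h =>
    obtain ⟨s, hs, rfl⟩ := h
    exact ⟨-s, neg_mem hs, Preadditive.comp_neg _ _⟩

variable [HasZeroObject 𝒞] [HasBinaryBiproducts 𝒞] (h𝔰 : IsNExangulated 𝔰) (hn : 0 < n)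

include h𝔰 hn

lemma mem_ideal_splitEpis_iff {g g' : SDef 𝔰} (φ : g ⟶ g') :
    φ ∈ ideal (splitEpis 𝔰) g g' ↔
      ∃ s : g.obj.right ⟶ g'.obj.left, s ≫ g'.obj.hom = φ.hom.right := by
  refine ⟨exists_lift_of_mem_ideal_splitEpis, fun ⟨s, hs⟩ => AddSubgroup.subset_closure ?_⟩
  -- `φ` factors through the split epimorphism `B ⊞ C ⟶ C`, where `g : B ⟶ C`
  let k : SDef 𝔰 := ⟨Arrow.mk (biprod.desc (0 : g.obj.left ⟶ g.obj.right) (𝟙 g.obj.right)),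
    isDeflation_desc h𝔰 hn 0 _ (isDeflation_id h𝔰 hn _)⟩
  have hk : splitEpis 𝔰 k := ⟨⟨⟨biprod.inr, biprod.inr_desc _ _⟩⟩⟩
  let a : g ⟶ k := ObjectProperty.homMk (Arrow.homMk
    (biprod.lift (𝟙 g.obj.left) g.obj.hom : g.obj.left ⟶ g.obj.left ⊞ g.obj.right)
    (𝟙 g.obj.right) (by simp [k]))
  let b : k ⟶ g' := ObjectProperty.homMk (Arrow.homMk
    (biprod.desc (φ.hom.left - g.obj.hom ≫ s) s : g.obj.left ⊞ g.obj.right ⟶ g'.obj.left)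
    φ.hom.right (by
      change _ ≫ g'.obj.hom = biprod.desc (0 : g.obj.left ⟶ g.obj.right) (𝟙 g.obj.right) ≫ _
      apply biprod.hom_ext' <;> simp [hs]))
  refine ⟨k, hk, a, b, ?_⟩
  apply ObjectProperty.hom_ext
  apply Arrow.hom_ext
  · change biprod.lift _ _ ≫ biprod.desc _ _ = φ.hom.left
    simp
  · exact Category.id_comp _

lemma toQuotient_splitEpis_map_eq_iff {g g' : SDef 𝔰} (φ ψ : g ⟶ g') :
    (toQuotient (splitEpis 𝔰)).map φ = (toQuotient (splitEpis 𝔰)).map ψ ↔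
      ∃ s : g.obj.right ⟶ g'.obj.left, s ≫ g'.obj.hom = φ.hom.right - ψ.hom.right :=
  (toQuotient_map_eq_iff _ _ _).trans (mem_ideal_splitEpis_iff h𝔰 hn _)

lemma isDefectSetting_deflations (hP : EnoughProjectives 𝔰) :
    IsDefectSetting (toQuotient (IsProjective 𝔰)) (deflations 𝔰).ι where
  lift φ := ⟨ObjectProperty.homMk φ, rfl⟩
  factors g T u hu := by
    obtain ⟨s, hs, hs'⟩ := exists_comp_eq_of_mem_ideal_isProjective g.property
      ((toQuotient_map_eq_zero_iff _ u).1 hu)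
    exact ⟨s, (toQuotient_map_eq_zero_iff _ s).2 hs, hs'⟩
  exists_extension {X Y} f := by
    obtain ⟨A, δ, Z, hZ, hZ'⟩ := hP Y
    refine ⟨⟨Arrow.mk (biprod.desc f Z.dLast), isDeflation_desc h𝔰 hn f _
      ⟨A, δ, Z, hZ, Iso.refl _, Category.id_comp _⟩⟩, Iso.refl _, biprod.inl, biprod.fst,
      biprod.inl_fst, ?_, ?_⟩
    · change biprod.inl ≫ biprod.desc f Z.dLast ≫ 𝟙 Y = f
      simp
    · refine (toQuotient_map_eq_iff _ _ _).2 (AddSubgroup.subset_closure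
        ⟨Z.K.X n, hZ' n hn le_rfl, -biprod.snd, Z.dLast, ?_⟩)
      change (-biprod.snd) ≫ Z.dLast = biprod.fst ≫ f - biprod.desc f Z.dLast ≫ 𝟙 Y
      simp [biprod.desc_eq]
  weak_kernel g := by
    obtain ⟨m, rfl⟩ : ∃ m, n = m + 1 := ⟨n - 1, by omega⟩
    obtain ⟨A, δ, X, hX, e, he⟩ := g.property
    refine ⟨X.K.X m, X.K.d m (m + 1) ≫ e.inv, ?_, fun {T} t ht => ?_⟩
    · refine (congrArg (_ ≫ ·) he.symm).trans ?_
      simp [CpxBetween.dLast]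
    · obtain ⟨s, hs⟩ := (h𝔰.exangle δ X hX).exists_comp_of_comp_dLast (t ≫ e.hom)
        ((Category.assoc _ _ _).trans ((congrArg (t ≫ ·) he).trans ht))
      refine ⟨s, ?_⟩
      rw [reassoc_of% hs, e.hom_inv_id]
      exact Category.comp_id t

theorem exists_equivalence_contravariantDefect (hP : EnoughProjectives 𝔰) :
    IsAbelianCategory (FPMod (ProjStable 𝔰)) ∧
      ∃ Θ : SDefQuotient 𝔰 ⥤ FPMod (ProjStable 𝔰), Θ.IsEquivalence ∧
        Nonempty (toQuotient (splitEpis 𝔰) ⋙ Θ ⋙ restrictProjStable 𝔰 ≅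
          contravariantDefect 𝔰) := by
  have h := isDefectSetting_deflations h𝔰 hn hP
  have hπ : ∀ Y : ProjStable 𝔰, ∃ X : 𝒞, (toQuotient (IsProjective 𝔰)).obj X = Y :=
    fun Y => ⟨Y.as, rfl⟩
  have := h.full_stableDefect
  have := h.essSurj_stableDefect hπ
  obtain ⟨Θ, hΘ, ⟨α⟩⟩ := exists_equivalence_of_homRel (toQuotient (splitEpis 𝔰))
    (stableDefect (toQuotient (IsProjective 𝔰)) (deflations 𝔰).ι) fun φ ψ =>
      (toQuotient_splitEpis_map_eq_iff h𝔰 hn φ ψ).trans (h.stableDefect_map_eq_iff φ ψ).symm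
  obtain ⟨β⟩ := h.nonempty_restrict_iso
  exact ⟨isAbelianCategory_fpMod (h.weakKernelsExist hπ), Θ, hΘ,
    ⟨Functor.isoWhiskerRight α (restrictProjStable 𝔰) ≪≫ β⟩⟩

lemma isDefectSetting_inflationOp [𝔼.Additive] (hI : EnoughInjectives 𝔰) :
    IsDefectSetting (toQuotient (IsInjective 𝔰)).op (RealizedExt.inflationOp 𝔰) where
  lift {D E} φ := by
    -- a square between inflations extends to a morphism of extensions
    let a : E.unop.A ⟶ D.unop.A := φ.right.unop
    let b : E.unop.X.K.X 1 ⟶ D.unop.X.K.X 1 := φ.left.unop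
    have ha : a ≫ D.unop.X.dFirst = E.unop.X.dFirst ≫ b :=
      congrArg Quiver.Hom.unop φ.w.symm
    obtain ⟨c, hc⟩ := exists_pull_eq h𝔰 hn D.unop.realizes (push a E.unop.δ) (by
      rw [← push_comp, ha, push_comp, (h𝔰.exangle _ _ E.unop.realizes).push_dFirst, push_zero])
    obtain ⟨f, hf⟩ := h𝔰.lift _ _ _ _ E.unop.realizes D.unop.realizes a c hc.symm
    exact ⟨Quiver.Hom.op (X := E.unop) (Y := D.unop) ⟨f, a, c, hf, hc.symm⟩, rfl⟩
  factors D T u hu := by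
    obtain ⟨s, hs, hs'⟩ := exists_comp_eq_of_mem_ideal_isInjective D.unop (u := u.unop)
      ((toQuotient_map_eq_zero_iff _ u.unop).1 (congrArg Quiver.Hom.unop hu))
    exact ⟨s.op, congrArg Quiver.Hom.op ((toQuotient_map_eq_zero_iff _ s).2 hs),
      congrArg Quiver.Hom.op hs'⟩
  exists_extension {X Y} f := by
    obtain ⟨C, δ, Z, hZ, hZ'⟩ := hI Y.unop
    obtain ⟨W, hW⟩ := exists_realizes 𝔰 (push f.unop δ)
    obtain ⟨h, hh, hh'⟩ := h𝔰.good_lift_op δ f.unop Z W hZ hW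
    let i : keep (1 ≤ n) (Z.K.X 1) ⊞ keep (0 ≤ n) (W.K.X 0) ⟶ X.unop :=
      biprod.snd ≫ keepι _ _ ≫ W.left.hom
    let j : X.unop ⟶ keep (1 ≤ n) (Z.K.X 1) ⊞ keep (0 ≤ n) (W.K.X 0) :=
      W.left.inv ≫ keepπ _ _ ≫ biprod.inr
    let d : Y.unop ⟶ keep (1 ≤ n) (Z.K.X 1) ⊞ keep (0 ≤ n) (W.K.X 0) :=
      biprod.lift (Z.dFirst ≫ keepπ _ _) (f.unop ≫ W.left.inv ≫ keepπ _ _)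
    have hd : (mappingCocone Z W h).dFirst = d := mappingCocone_dFirst hh
    have h₁ : j ≫ i = 𝟙 _ := by simp [i, j, reassoc_of% keepπ_keepι (Nat.zero_le n)]
    have h₂ : d ≫ i = f.unop := by simp [d, i, reassoc_of% keepπ_keepι (Nat.zero_le n)]
    have h₃ : f.unop ≫ j - d ∈ ideal (IsInjective 𝔰) _ _ := by
      refine AddSubgroup.subset_closure ⟨Z.K.X 1, hZ' 1 le_rfl hn, -Z.dFirst,
        keepπ _ _ ≫ biprod.inl, ?_⟩
      simp [d, j, biprod.lift_eq]
    refine ⟨op ⟨_, _, _, mappingCocone Z W h, hh'⟩, Iso.refl _, i.op, j.op,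
      congrArg Quiver.Hom.op h₁, ?_, ?_⟩
    · refine Eq.trans ?_ (congrArg Quiver.Hom.op h₂)
      rw [← hd]
      exact congrArg (i.op ≫ ·) (Category.comp_id _)
    · refine Eq.trans ?_ ((congrArg Quiver.Hom.op ((toQuotient_map_eq_iff _ _ _).2 h₃)).trans ?_)
      · rfl
      · rw [← hd]
        exact congrArg (toQuotient (IsInjective 𝔰)).op.map
          (Category.comp_id (mappingCocone Z W h).dFirst.op).symm
  weak_kernel D := by
    obtain ⟨m, rfl⟩ : ∃ m, n = m + 1 := ⟨n - 1, by omega⟩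
    refine ⟨op (D.unop.X.K.X 2), (D.unop.X.K.d 1 2).op, ?_, fun {T} t ht => ?_⟩
    · have h : D.unop.X.dFirst ≫ D.unop.X.K.d 1 2 = 0 := by simp [CpxBetween.dFirst]
      exact congrArg Quiver.Hom.op h
    · obtain ⟨s, hs⟩ := (h𝔰.exangle _ _ D.unop.realizes).exists_comp_of_dFirst_comp t.unop
        (congrArg Quiver.Hom.unop ht)
      exact ⟨s.op, congrArg Quiver.Hom.op hs⟩

/-- A square between deflations agrees, modulo split epimorphisms, with one that comes from a
morphism of extensions. -/
lemma full_deflation_toQuotient [∀ C : 𝒞ᵒᵖ, (𝔼.obj C).Additive] :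
    (RealizedExt.deflation 𝔰 ⋙ toQuotient (splitEpis 𝔰)).Full where
  map_surjective {D E} φ := by
    obtain ⟨φ, rfl⟩ := (toQuotient (splitEpis 𝔰)).map_surjective φ
    let c : D.C ⟶ E.C := φ.hom.right
    let b : D.X.K.X n ⟶ E.X.K.X n := φ.hom.left
    have hc : b ≫ E.X.dLast = D.X.dLast ≫ c := φ.hom.w
    obtain ⟨a, ha⟩ := exists_push_eq h𝔰 D.realizes (pull c E.δ) (by
      rw [← pull_comp, ← hc, pull_comp, (h𝔰.exangle _ _ E.realizes).pull_dLast, pull_zero])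
    obtain ⟨f, hf⟩ := h𝔰.lift _ _ _ _ D.realizes E.realizes a c ha
    refine ⟨⟨f, a, c, hf, ha⟩, (toQuotient_splitEpis_map_eq_iff h𝔰 hn _ _).2 ⟨0, ?_⟩⟩
    rw [zero_comp]
    exact (sub_self c).symm

variable [𝔼.Additive] [∀ C : 𝒞ᵒᵖ, (𝔼.obj C).Additive]

/-- A morphism of realized extensions vanishes on the contravariant defects if and only if it
vanishes on the covariant ones. -/
lemma deflation_map_eq_iff (hI : EnoughInjectives 𝔰) {D E : RealizedExt 𝔰} (φ ψ : D ⟶ E) :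
    (toQuotient (splitEpis 𝔰)).map ((RealizedExt.deflation 𝔰).map φ) =
      (toQuotient (splitEpis 𝔰)).map ((RealizedExt.deflation 𝔰).map ψ) ↔
    (stableDefect (toQuotient (IsInjective 𝔰)).op (RealizedExt.inflationOp 𝔰)).map φ.op =
      (stableDefect (toQuotient (IsInjective 𝔰)).op (RealizedExt.inflationOp 𝔰)).map ψ.op := by
  rw [toQuotient_splitEpis_map_eq_iff h𝔰 hn,
    (isDefectSetting_inflationOp h𝔰 hn hI).stableDefect_map_eq_iff]
  have h₁ := (h𝔰.exangle _ _ E.realizes).exact_contra_last _ (φ.c - ψ.c)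
  have h₂ := (h𝔰.exangle _ _ D.realizes).exact_co_first _ (φ.a - ψ.a)
  rw [sub_pull, ← φ.comm, ← ψ.comm, ← sub_push, h₂] at h₁
  refine h₁.symm.trans ⟨fun ⟨s, hs⟩ => ⟨s.op, congrArg Quiver.Hom.op hs⟩, fun ⟨s, hs⟩ =>
    ⟨s.unop, congrArg Quiver.Hom.unop hs⟩⟩

theorem exists_equivalence_covariantDefect (hI : EnoughInjectives 𝔰) :
    IsAbelianCategory (FPMod (InjStable 𝔰)ᵒᵖ) ∧
      ∃ Φ : SDefQuotient 𝔰 ⥤ (FPMod (InjStable 𝔰)ᵒᵖ)ᵒᵖ, Φ.IsEquivalence ∧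
        Nonempty ((DistExangle.deflation 𝔰 ⋙ toQuotient (splitEpis 𝔰) ⋙ Φ).leftOp ⋙
          restrictInjStable 𝔰 ≅ covariantDefect 𝔰) := by
  have h := isDefectSetting_inflationOp h𝔰 hn hI
  have hπ : ∀ Y : (InjStable 𝔰)ᵒᵖ, ∃ X : 𝒞ᵒᵖ, (toQuotient (IsInjective 𝔰)).op.obj X = Y :=
    fun Y => ⟨op Y.unop.as, rfl⟩
  have := h.full_stableDefect
  have := h.essSurj_stableDefect hπ
  have := full_deflation_toQuotient h𝔰 hn
  have := essSurj_deflation (𝔰 := 𝔰)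
  let R := stableDefect (toQuotient (IsInjective 𝔰)).op (RealizedExt.inflationOp 𝔰)
  obtain ⟨Φ, hΦ, ⟨α⟩⟩ := exists_equivalence_of_homRel
    (RealizedExt.deflation 𝔰 ⋙ toQuotient (splitEpis 𝔰)) R.rightOp fun φ ψ =>
      (deflation_map_eq_iff h𝔰 hn hI φ ψ).trans (Quiver.Hom.op_inj.eq_iff).symm
  obtain ⟨β⟩ := h.nonempty_restrict_iso
  let γ : RealizedExt.ofDistExangle 𝔰 ⋙ R.rightOp ≅
      DistExangle.deflation 𝔰 ⋙ toQuotient (splitEpis 𝔰) ⋙ Φ :=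
    Functor.isoWhiskerLeft (RealizedExt.ofDistExangle 𝔰) α.symm ≪≫
      Functor.isoWhiskerRight (RealizedExt.ofDistExangleDeflationIso 𝔰)
        (toQuotient (splitEpis 𝔰) ⋙ Φ)
  let γ' : (DistExangle.deflation 𝔰 ⋙ toQuotient (splitEpis 𝔰) ⋙ Φ).leftOp ≅
      (RealizedExt.ofDistExangle 𝔰).op ⋙ R :=
    NatIso.ofComponents (fun X => (γ.app X.unop).unop)
      fun f => congrArg Quiver.Hom.unop (γ.hom.naturality f.unop).symm
  exact ⟨isAbelianCategory_fpMod (h.weakKernelsExist hπ), Φ, hΦ,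
    ⟨Functor.isoWhiskerRight γ' (restrictInjStable 𝔰) ≪≫
      Functor.isoWhiskerLeft (RealizedExt.ofDistExangle 𝔰).op β ≪≫
      Functor.isoWhiskerRight (RealizedExt.ofDistExangleInflationOpIso 𝔰)
        ((preadditiveYoneda (C := 𝒞ᵒᵖ)).mapArrow ⋙ coker _)⟩⟩

end Realizations

end

end NExangulated

theorem proposition3p3 {𝒞 : Type u} [Category.{v} 𝒞] [Preadditive 𝒞]
    [HasZeroObject 𝒞] [HasBinaryBiproducts 𝒞] (n : ℕ) (hn : 0 < n)
    (𝔼 : 𝒞ᵒᵖ ⥤ 𝒞 ⥤ AddCommGrpCat.{w}) [𝔼.Additive] [∀ C : 𝒞ᵒᵖ, (𝔼.obj C).Additive]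
    (𝔰 : NExangulated.Correspondence 𝔼 n) (h𝔰 : NExangulated.IsNExangulated 𝔰) :
    (NExangulated.EnoughProjectives 𝔰 →
      NExangulated.IsAbelianCategory (NExangulated.SDefQuotient 𝔰) ∧
      NExangulated.IsAbelianCategory (NExangulated.FPMod (NExangulated.ProjStable 𝔰)) ∧
      ∃ Θ : NExangulated.SDefQuotient 𝔰 ⥤ NExangulated.FPMod (NExangulated.ProjStable 𝔰),
        Θ.IsEquivalence ∧ Θ.Additive ∧
        Nonempty (NExangulated.toQuotient (NExangulated.splitEpis 𝔰) ⋙ Θ ⋙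
          NExangulated.restrictProjStable 𝔰 ≅ NExangulated.contravariantDefect 𝔰)) ∧
    (NExangulated.EnoughInjectives 𝔰 →
      NExangulated.IsAbelianCategory (NExangulated.SDefQuotient 𝔰) ∧
      NExangulated.IsAbelianCategory (NExangulated.FPMod (NExangulated.InjStable 𝔰)ᵒᵖ) ∧
      ∃ Φ : NExangulated.SDefQuotient 𝔰 ⥤ (NExangulated.FPMod (NExangulated.InjStable 𝔰)ᵒᵖ)ᵒᵖ,
        Φ.IsEquivalence ∧ Φ.Additive ∧
        Nonempty ((NExangulated.DistExangle.deflation 𝔰 ⋙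
            NExangulated.toQuotient (NExangulated.splitEpis 𝔰) ⋙ Φ).leftOp ⋙
          NExangulated.restrictInjStable 𝔰 ≅ NExangulated.covariantDefect 𝔰)) := by
  refine ⟨fun hP => ?_, fun hI => ?_⟩
  · obtain ⟨h, Θ, hΘ, hΘ'⟩ :=
      NExangulated.exists_equivalence_contravariantDefect h𝔰 hn hP
    obtain ⟨h₁, h₂⟩ := NExangulated.IsAbelianCategory.of_equivalence Θ h
    exact ⟨h₁, h, Θ, hΘ, h₂, hΘ'⟩
  · obtain ⟨h, Φ, hΦ, hΦ'⟩ :=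
      NExangulated.exists_equivalence_covariantDefect h𝔰 hn hI
    obtain ⟨h₁, h₂⟩ := NExangulated.IsAbelianCategory.of_equivalence Φ h.op
    exact ⟨h₁, h, Φ, hΦ, h₂, hΦ'⟩
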